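/- **Corollary 1.7.** There is no universal matroid for the class of countable planar matroids. That is, no countable planar matroid has every countable planar matroid as a minor. Here matroids may be infinite (they satisfy the independence axioms (I1)–(I3) and (IM) of Bruhn, Diestel, Kriesell, Pendavingh and Wollan), and a matroid is *countable* if its ground set is countable. A matroid is *tame* if the intersection of any circuit with any cocircuit is finite. A finite matroid is *planar* if it is the cycle matroid of a finite planar graph (loops and parallel edges allowed), and an arbitrary matroid is *planar* if it is tame and all its finite minors are planar. A matroid $M$ *has $N$ as a minor* if $N$ is isomorphic to $M/C\setminus D$ for some disjoint subsets $C, D$ of the ground set of $M$. A matroid $M$ is *universal* for a class $\mathcal{F}$ of matroids if $M\in\mathcal{F}$ and $M$ has every member of $\mathcal{F}$ as a minor. -/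

import Mathlib

namespace Graph

/-- `C` is the edge set of a (finite) cycle of the multigraph `G`: there are distinct vertices
`v 0, …, v n` and distinct edges `e 0, …, e n` such that `e i` joins `v i` to `v (i + 1)`, where the
indices are read modulo `n + 1`. A single loop (`n = 0`) and a pair of parallel edges (`n = 1`)
form cycles. -/
def IsCycleEdgeSet {V α : Type*} (G : Graph V α) (C : Set α) : Prop :=
  ∃ (n : ℕ) (v : Fin (n + 1) → V) (e : Fin (n + 1) → α),
    Function.Injective v ∧ Function.Injective e ∧
      (∀ i, G.IsLink (e i) (v i) (v (i + 1))) ∧ Set.range e = C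

/-- A drawing of the multigraph `G` in the plane without crossings: the vertices are represented by
distinct points, each edge is represented by a simple curve joining the points that represent its
ends (a simple closed curve if the edge is a loop), the interior of such a curve contains no point
that represents a vertex, and the interiors of the curves of distinct edges are disjoint. -/
structure PlaneDrawing {V α : Type*} (G : Graph V α) where
  point : V → ℝ × ℝ
  arc : α → ℝ → ℝ × ℝ
  point_injOn : Set.InjOn point G.vertexSet
  arc_continuousOn : ∀ e ∈ G.edgeSet, ContinuousOn (arc e) (Set.Icc 0 1)
  arc_injOn : ∀ e ∈ G.edgeSet, Set.InjOn (arc e) (Set.Ioo 0 1)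
  arc_ends : ∀ e ∈ G.edgeSet, ∃ x y, G.IsLink e x y ∧ arc e 0 = point x ∧ arc e 1 = point y
  arc_ne_point : ∀ e ∈ G.edgeSet, ∀ t ∈ Set.Ioo (0 : ℝ) 1, ∀ x ∈ G.vertexSet, arc e t ≠ point x
  arc_disjoint : ∀ e ∈ G.edgeSet, ∀ f ∈ G.edgeSet, e ≠ f →
    Disjoint (arc e '' Set.Ioo 0 1) (arc f '' Set.Ioo 0 1)

/-- `G` is planar if it can be drawn in the plane without crossings. -/
def IsPlanar {V α : Type*} (G : Graph V α) : Prop := Nonempty G.PlaneDrawing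

end Graph

namespace Matroid

universe u v

/-- `M` is the (finite) cycle matroid of `G`: its elements are the edges of `G` and its circuits
are the edge sets of the cycles of `G`. -/
def IsCycleMatroidOf {V α : Type*} (M : Matroid α) (G : Graph V α) : Prop :=
  M.E = G.edgeSet ∧ ∀ C : Set α, M.IsCircuit C ↔ G.IsCycleEdgeSet C

/-- A finite matroid is planar if it is the cycle matroid of a finite planar graph. (Being
isomorphic to such a cycle matroid is the same, since the edges may be renamed.) -/
def IsFinitePlanar {α : Type*} (M : Matroid α) : Prop :=
  M.E.Finite ∧ ∃ (V : Type) (G : Graph V α),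
    G.vertexSet.Finite ∧ G.IsPlanar ∧ M.IsCycleMatroidOf G

/-- A matroid is tame if every intersection of a circuit with a cocircuit is finite. -/
def IsTame {α : Type*} (M : Matroid α) : Prop :=
  ∀ C K : Set α, M.IsCircuit C → M.IsCocircuit K → (C ∩ K).Finite

/-- A (possibly infinite) matroid is planar if it is tame and all its finite minors are planar. -/
def IsPlanar {α : Type*} (M : Matroid α) : Prop :=
  M.IsTame ∧ ∀ N : Matroid α, N ≤m M → N.E.Finite → N.IsFinitePlanar

/-- Two matroids are isomorphic if there is a bijection between their ground sets that preserves
independence in both directions. -/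
def IsIsomorphic {α : Type u} {β : Type v} (M : Matroid α) (N : Matroid β) : Prop :=
  ∃ f : M.E ≃ N.E, ∀ I : Set M.E,
    M.Indep ((fun x : M.E => (x : α)) '' I) ↔ N.Indep ((fun x : M.E => (f x : β)) '' I)

/-- `M` has `N` as a minor, in the usual sense that some minor of `M` is isomorphic to `N`. -/
def HasAsMinor {α : Type u} {β : Type v} (M : Matroid α) (N : Matroid β) : Prop :=
  ∃ M' : Matroid α, M' ≤m M ∧ M'.IsIsomorphic N

/-- `M` is universal for the class `F` of matroids (with respect to the minor relation) if it is in
`F` and has every member of `F` as a minor. -/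
def IsUniversalFor (F : ∀ {β : Type u}, Matroid β → Prop) {α : Type u} (M : Matroid α) : Prop :=
  F M ∧ ∀ (β : Type u) (N : Matroid β), F N → M.HasAsMinor N

/-- The class of countable planar matroids; countable means that the ground set is countable. -/
def IsCountablePlanar {α : Type u} (M : Matroid α) : Prop :=
  M.E.Countable ∧ M.IsPlanar

end Matroid

open Set

/-! The proof counts. Every set `Z` of branches of the infinite binary tree gives a matroid
`treeMatroid Z` on the countable set of nodes, in which a set is independent if each of its nodes is
its last node on some branch in `Z`. These matroids are planar (`treeMatroid_isCountablePlanar`) and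
determine `Z` (`treeMatroid_injective`), so there are as many of them as subsets of `ℕ → Bool`. A
countable matroid has at most continuum many minors labelled by nodes, because the contracted set,
the deleted set and the labelling form a subset of one countable type (`HasAsMinor.exists_code`).
Cantor's theorem does the rest.

The exchange axiom rests on fundamental cocycles, which are single branches or symmetric differences
of two (`exists_cocycle`, `exists_mem_cocycle`); the maximality axiom
(`existsMaximalSubsetProperty`) rests on a greedy choice along the tree. Every cocircuit is the
trace of such a cocycle, and a circuit meets a branch in at most two elements, so the matroid is
tame. The same description of cocircuits recovers `Z`.

A finite minor is a contraction of a branch matroid on a finite set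
(`branchMatroid_exists_finite_contract`). There, a deepest element or a sibling of it is contracted,
a loop or a coloop, or the deepest element is spanned by its predecessor or in series with a
sibling. Induction therefore builds the minor by adding loops, coloops, parallel edges and
subdivisions (`branchMatroid_contract_isLensGraphic`). Edges are drawn as thick lenses, so that each
operation happens inside one lens or to the right of the drawing, by explicit formulas. -/

/-- A family of branches of a tree: chains that are closed downwards and in which every element
has only finitely many predecessors. -/
structure IsBranchFamily {α : Type*} [PartialOrder α] (Ω : Set (Set α)) : Prop where
  lower : ∀ b ∈ Ω, IsLowerSet b
  chain : ∀ b ∈ Ω, ∀ s ∈ b, ∀ t ∈ b, s ≤ t ∨ t ≤ s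
  finite : ∀ b ∈ Ω, ∀ s ∈ b, (Iic s).Finite

/-- A set of elements of a tree is branch independent if each of its elements is the last element
of the set on some branch of the family. -/
def BranchIndep {α : Type*} [PartialOrder α] (E : Set α) (Ω : Set (Set α)) (J : Set α) : Prop :=
  J ⊆ E ∧ ∀ s ∈ J, ∃ b ∈ Ω, s ∈ b ∧ ∀ t ∈ J, t ∈ b → t ≤ s

/-- The set `K` consists of the elements of one branch, or of the elements of exactly one of two
branches. -/
def IsBranchCocycle {α : Type*} (Ω : Set (Set α)) (K : Set α) : Prop :=
  K ∈ Ω ∨ ∃ b ∈ Ω, ∃ c ∈ Ω, K = symmDiff b c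

/-! ### Branch independent sets and the matroid axioms -/

section

variable {α : Type*} [PartialOrder α] {E J I B K X : Set α} {Ω : Set (Set α)} {x y s t : α}

namespace IsBranchFamily

lemma mono (h : IsBranchFamily Ω) {Ω' : Set (Set α)} (hsub : Ω' ⊆ Ω) : IsBranchFamily Ω' where
  lower b hb := h.lower b (hsub hb)
  chain b hb := h.chain b (hsub hb)
  finite b hb := h.finite b (hsub hb)

lemma exists_last_lt (h : IsBranchFamily Ω) {b : Set α} (hb : b ∈ Ω) (hs : s ∈ b) (J : Set α) :
    (∀ t ∈ J, ¬ t < s) ∨ ∃ t ∈ J, t < s ∧ ∀ u ∈ J, u < s → u ≤ t := by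
  by_cases hne : (J ∩ Iio s).Nonempty
  · right
    have hfin : (J ∩ Iio s).Finite :=
      (h.finite b hb s hs).subset (inter_subset_right.trans Iio_subset_Iic_self)
    obtain ⟨t, ht⟩ := hfin.exists_maximal hne
    refine ⟨t, ht.1.1, ht.1.2, fun u hu hus ↦ ?_⟩
    rcases h.chain b hb u (h.lower b hb hus.le hs) t (h.lower b hb ht.1.2.le hs) with h1 | h1
    · exact h1
    · exact ht.2 ⟨hu, hus⟩ h1
  · left
    exact fun t ht hts ↦ hne ⟨t, ht, hts⟩

end IsBranchFamily

namespace BranchIndep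

lemma empty : BranchIndep E Ω ∅ := ⟨empty_subset _, by simp⟩

lemma subset (hJ : BranchIndep E Ω J) (hIJ : I ⊆ J) : BranchIndep E Ω I :=
  ⟨hIJ.trans hJ.1, fun s hs ↦
    let ⟨b, hb, hsb, h⟩ := hJ.2 s (hIJ hs)
    ⟨b, hb, hsb, fun t ht htb ↦ h t (hIJ ht) htb⟩⟩

/-- Adding `y` can spoil the branch of an `s ∈ I` only if that branch continues through `y` beyond
`s`. Then all elements of `I` below `y` lie on it, so `s` is the last of them: only the predecessor
of `y` may need a new branch. -/
lemma insert (hΩ : IsBranchFamily Ω) (hI : BranchIndep E Ω I) (hy : y ∈ E) {b : Set α} (hb : b ∈ Ω)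
    (hyb : y ∈ b) (hlast : ∀ z ∈ I, z ∈ b → z ≤ y)
    (hpred : ∀ t ∈ I, t < y → (∀ z ∈ I, z < y → z ≤ t) →
      ∃ c ∈ Ω, t ∈ c ∧ y ∉ c ∧ ∀ z ∈ I, z ∈ c → z ≤ t) :
    BranchIndep E Ω (insert y I) := by
  refine ⟨insert_subset hy hI.1, ?_⟩
  rintro s (rfl | hs)
  · refine ⟨b, hb, hyb, ?_⟩
    rintro t (rfl | ht) htb
    exacts [le_rfl, hlast t ht htb]
  obtain ⟨c, hc, hsc, h⟩ := hI.2 s hs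
  by_cases hyc : y ∈ c
  · rcases hΩ.chain c hc y hyc s hsc with hys | hsy
    · refine ⟨c, hc, hsc, ?_⟩
      rintro t (rfl | ht) htc
      exacts [hys, h t ht htc]
    · rcases hsy.eq_or_lt with rfl | hlt
      · refine ⟨c, hc, hsc, ?_⟩
        rintro t (rfl | ht) htc
        exacts [le_rfl, h t ht htc]
      obtain ⟨d, hd, hsd, hyd, h'⟩ := hpred s hs hlt
        fun z hz hzy ↦ h z hz (hΩ.lower c hc hzy.le hyc)
      refine ⟨d, hd, hsd, ?_⟩
      rintro t (rfl | ht) htd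
      exacts [absurd htd hyd, h' t ht htd]
  · refine ⟨c, hc, hsc, ?_⟩
    rintro t (rfl | ht) htc
    exacts [absurd htc hyc, h t ht htc]

/-- This is the fundamental cocycle of `x`. Let `b` be a branch on which `x` is last. If `I` has
nothing below `x`, then `b` misses `I`. Otherwise let `t` be the predecessor of `x` in `I` and `c`
its branch: `b` and `c` both have `t` as last element of `I`, so for `y` on just one of them, that
one serves `y` and the other serves `t`. -/
lemma exists_cocycle (hΩ : IsBranchFamily Ω) (hxI : x ∉ I)
    (hI : BranchIndep E Ω (Insert.insert x I)) :
    ∃ K, IsBranchCocycle Ω K ∧ x ∈ K ∧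
      ∀ y ∈ K ∩ E, y ∉ I ∧ BranchIndep E Ω (Insert.insert y I) := by
  have hI' := hI.subset (subset_insert x I)
  obtain ⟨b, hb, hxb, hlast⟩ := hI.2 x (mem_insert _ _)
  have hlastb : ∀ z ∈ I, z ∈ b → z < x := fun z hz hzb ↦
    (hlast z (mem_insert_of_mem _ hz) hzb).lt_of_ne (by rintro rfl; exact hxI hz)
  rcases hΩ.exists_last_lt hb hxb I with hno | ⟨t, htI, htx, ht⟩
  · have hbI : ∀ z ∈ b, z ∉ I := fun z hzb hz ↦ hno z hz (hlastb z hz hzb)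
    refine ⟨b, .inl hb, hxb, fun y hy ↦ ⟨hbI y hy.1, hI'.insert hΩ hy.2 hb hy.1 ?_ ?_⟩⟩
    · exact fun z hz hzb ↦ absurd hz (hbI z hzb)
    · exact fun t htI hty ↦ absurd htI (hbI t (hΩ.lower b hb hty.le hy.1))
  obtain ⟨c, hc, htc, hlastc⟩ := hI.2 t (mem_insert_of_mem _ htI)
  have hxc : x ∉ c := fun hxc ↦ (hlastc x (mem_insert _ _) hxc).not_gt htx
  have htb : t ∈ b := hΩ.lower b hb htx.le hxb
  have hlb : ∀ z ∈ I, z ∈ b → z ≤ t := fun z hz hzb ↦ ht z hz (hlastb z hz hzb)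
  have hlc : ∀ z ∈ I, z ∈ c → z ≤ t := fun z hz hzc ↦ hlastc z (mem_insert_of_mem _ hz) hzc
  have key : ∀ b ∈ Ω, ∀ c ∈ Ω, t ∈ b → t ∈ c → (∀ z ∈ I, z ∈ b → z ≤ t) →
      (∀ z ∈ I, z ∈ c → z ≤ t) → ∀ y ∈ E, y ∈ b → y ∉ c →
      y ∉ I ∧ BranchIndep E Ω (Insert.insert y I) := by
    intro b hb c hc htb htc hlb hlc y hyE hyb hyc
    have hty : t < y := by
      rcases hΩ.chain b hb t htb y hyb with h | h
      · exact h.lt_of_ne (by rintro rfl; exact hyc htc)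
      · exact absurd (hΩ.lower c hc h htc) hyc
    refine ⟨fun hyI ↦ hyc (hΩ.lower c hc (hlb y hyI hyb) htc),
      hI'.insert hΩ hyE hb hyb (fun z hz hzb ↦ (hlb z hz hzb).trans hty.le) ?_⟩
    intro t' ht' hty' hmax
    obtain rfl : t' = t := (hlb t' ht' (hΩ.lower b hb hty'.le hyb)).antisymm (hmax t htI hty)
    exact ⟨c, hc, htc, hyc, hlc⟩
  refine ⟨symmDiff b c, .inr ⟨b, hb, c, hc, rfl⟩, .inl ⟨hxb, hxc⟩, ?_⟩
  rintro y ⟨⟨hyb, hyc⟩ | ⟨hyc, hyb⟩, hyE⟩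
  · exact key b hb c hc htb htc hlb hlc y hyE hyb hyc
  · exact key c hc b hb htc htb hlc hlb y hyE hyc hyb

/-- If `K` missed `B`, then `x` could be added to `B`: in the case of two branches, both contain the
same elements of `B`, so the one through `x` serves `x` and the other serves its predecessor. -/
lemma exists_mem_cocycle (hΩ : IsBranchFamily Ω) (hB : Maximal (BranchIndep E Ω) B)
    (hK : IsBranchCocycle Ω K) (hx : x ∈ K) (hxE : x ∈ E) : (K ∩ B).Nonempty := by
  by_contra hdisj
  rw [not_nonempty_iff_eq_empty] at hdisj
  have hKB : ∀ z ∈ K, z ∉ B := fun z hz hzB ↦ (hdisj ▸ (⟨hz, hzB⟩ : z ∈ K ∩ B) : z ∈ (∅ : Set α))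
  have hxB := hKB x hx
  suffices BranchIndep E Ω (Insert.insert x B) from
    hxB (hB.2 this (subset_insert _ _) (mem_insert _ _))
  have key : ∀ b ∈ Ω, ∀ c ∈ Ω, x ∈ b → x ∉ c → K = symmDiff b c →
      BranchIndep E Ω (Insert.insert x B) := by
    rintro b hb c hc hxb hxc rfl
    have hbc : ∀ z ∈ B, z ∈ b → z ∈ c := fun z hz hzb ↦ by
      by_contra hzc
      exact hKB z (.inl ⟨hzb, hzc⟩) hz
    have hcb : ∀ z ∈ B, z ∈ c → z ∈ b := fun z hz hzc ↦ by
      by_contra hzb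
      exact hKB z (.inr ⟨hzc, hzb⟩) hz
    have hlt : ∀ z ∈ B, z ∈ b → z < x := fun z hz hzb ↦ by
      rcases hΩ.chain b hb z hzb x hxb with h | h
      · exact h.lt_of_ne (by rintro rfl; exact hxB hz)
      · exact absurd (hΩ.lower c hc h (hbc z hz hzb)) hxc
    refine hB.1.insert hΩ hxE hb hxb (fun z hz hzb ↦ (hlt z hz hzb).le) fun t ht htx hmax ↦ ?_
    exact ⟨c, hc, hbc t ht (hΩ.lower b hb htx.le hxb), hxc,
      fun z hz hzc ↦ hmax z hz (hlt z hz (hcb z hz hzc))⟩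
  rcases hK with hK | ⟨b, hb, c, hc, rfl⟩
  · exact hB.1.insert hΩ hxE hK hx (fun z hz hzK ↦ absurd hz (hKB z hzK))
      fun t ht htx ↦ absurd ht (hKB t (hΩ.lower K hK htx.le hx))
  · rcases hx with ⟨hxb, hxc⟩ | ⟨hxc, hxb⟩
    · exact key b hb c hc hxb hxc rfl
    · exact key c hc b hb hxc hxb (symmDiff_comm _ _)

lemma augment (hΩ : IsBranchFamily Ω) (hI : BranchIndep E Ω I)
    (hmax : ¬ Maximal (BranchIndep E Ω) I) (hB : Maximal (BranchIndep E Ω) B) :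
    ∃ x ∈ B \ I, BranchIndep E Ω (Insert.insert x I) := by
  obtain ⟨J, hJ, hIJ, hne⟩ : ∃ J, BranchIndep E Ω J ∧ I ⊆ J ∧ ¬ J ⊆ I := by
    by_contra! h
    exact hmax ⟨hI, fun J hJ hIJ ↦ h J hJ hIJ⟩
  obtain ⟨x, hxJ, hxI⟩ := not_subset.1 hne
  have hx := hJ.subset (insert_subset hxJ hIJ)
  obtain ⟨K, hK, hxK, hall⟩ := exists_cocycle hΩ hxI hx
  obtain ⟨y, hyK, hyB⟩ := exists_mem_cocycle hΩ hB hK hxK (hJ.1 hxJ)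
  have := hall y ⟨hyK, hB.1.1 hyB⟩
  exact ⟨y, ⟨hyB, this.1⟩, this.2⟩

/-- A choice of a branch through `t` that avoids `I` beyond `t`, and subject to this has as few
elements of `X` as possible. -/
lemma exists_branch_choice (Ω : Set (Set α)) (I X : Set α) : ∃ w : α → Set α,
    ∀ t, ∀ b ∈ Ω, t ∈ b → (∀ z ∈ I, z ∈ b → z ≤ t) →
      w t ∈ Ω ∧ t ∈ w t ∧ (∀ z ∈ I, z ∈ w t → z ≤ t) ∧ (X ∩ w t).encard ≤ (X ∩ b).encard := by
  have (t : α) : ∃ w : Set α, ∀ b ∈ Ω, t ∈ b → (∀ z ∈ I, z ∈ b → z ≤ t) →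
      w ∈ Ω ∧ t ∈ w ∧ (∀ z ∈ I, z ∈ w → z ≤ t) ∧ (X ∩ w).encard ≤ (X ∩ b).encard := by
    let A := {b | b ∈ Ω ∧ t ∈ b ∧ ∀ z ∈ I, z ∈ b → z ≤ t}
    by_cases hA : A.Nonempty
    -- The minimum exists because `ℕ∞` is well-ordered; the value may be infinite.
    · have hw := Function.argminOn_mem (fun b ↦ (X ∩ b).encard) A hA
      refine ⟨Function.argminOn (fun b ↦ (X ∩ b).encard) A hA, fun b hb htb hlast ↦
        ⟨hw.1, hw.2.1, hw.2.2, ?_⟩⟩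
      exact Function.argminOn_le (fun b ↦ (X ∩ b).encard) A (a := b) ⟨hb, htb, hlast⟩
    · exact ⟨∅, fun b hb htb hlast ↦ (hA ⟨b, hb, htb, hlast⟩).elim⟩
  choose w hw using this
  exact ⟨w, hw⟩

lemma exists_greedy [WellFoundedLT α] (P : α → Prop) (Q : α → α → Prop) : ∃ J : Set α,
    ∀ s, s ∈ J ↔ s ∈ I ∨ (P s ∧ ∀ t ∈ J, t < s → (∀ z ∈ J, z < s → z ≤ t) → Q t s) := by
  let F : ∀ s : α, (∀ t, t < s → Prop) → Prop := fun s f ↦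
    s ∈ I ∨ (P s ∧ ∀ t, ∀ h : t < s, f t h → (∀ z, ∀ hz : z < s, f z hz → z ≤ t) → Q t s)
  let p : α → Prop := (wellFounded_lt (α := α)).fix F
  have hp (s) : p s ↔ s ∈ I ∨
      (P s ∧ ∀ t, t < s → p t → (∀ z, z < s → p z → z ≤ t) → Q t s) := by
    change (wellFounded_lt (α := α)).fix F s ↔ _
    rw [WellFounded.fix_eq]
  refine ⟨{s | p s}, fun s ↦ ?_⟩
  change p s ↔ _
  rw [hp]
  simp only [mem_ofPred_eq]
  grind

/-- Reserve for each `t` a branch `w t` that contains as little of `X` as possible. Going up the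
tree, accept every element of `X` that has a branch compatible with `I`, unless it lies on the
branch reserved for its predecessor. The reserved branches show independence, and their minimality
shows that the result cannot be enlarged. -/
lemma existsMaximalSubsetProperty [WellFoundedLT α] (hΩ : IsBranchFamily Ω) (hX : X ⊆ E) :
    Matroid.ExistsMaximalSubsetProperty (BranchIndep E Ω) X := by
  intro I hI hIX
  obtain ⟨w, hw⟩ := exists_branch_choice Ω I X
  obtain ⟨J, hJ⟩ := exists_greedy (I := I)
    (fun s ↦ s ∈ X ∧ ∃ b ∈ Ω, s ∈ b ∧ ∀ z ∈ I, z ∈ b → z ≤ s) (fun t s ↦ s ∉ w t)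
  have hIJ : I ⊆ J := fun s hs ↦ (hJ s).2 (.inl hs)
  have hJX : J ⊆ X := fun s hs ↦ ((hJ s).1 hs).elim (fun h ↦ hIX h) fun h ↦ h.1.1
  have havail : ∀ s ∈ J, ∃ b ∈ Ω, s ∈ b ∧ ∀ z ∈ I, z ∈ b → z ≤ s := fun s hs ↦
    ((hJ s).1 hs).elim (fun h ↦ hI.2 s h) fun h ↦ h.1.2
  have hJi : BranchIndep E Ω J := by
    refine ⟨hJX.trans hX, fun t ht ↦ ?_⟩
    obtain ⟨b, hb, htb, hlast⟩ := havail t ht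
    obtain ⟨hwΩ, htw, hwlast, -⟩ := hw t b hb htb hlast
    refine ⟨w t, hwΩ, htw, ?_⟩
    by_contra! hex
    -- The first element of `J` beyond `t` on `w t` has predecessor `t`, so it was accepted despite
    -- lying on the reserved branch.
    obtain ⟨s, hs⟩ : ∃ s, Minimal (fun s ↦ s ∈ J ∧ s ∈ w t ∧ t < s) s := by
      obtain ⟨u, huJ, huw, hut⟩ := hex
      have htu : t < u := ((hΩ.chain _ hwΩ t htw u huw).resolve_right hut).lt_of_not_ge hut
      obtain ⟨s, -, hs⟩ := exists_minimal_le_of_wellFoundedLT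
        (fun s ↦ s ∈ J ∧ s ∈ w t ∧ t < s) u ⟨huJ, huw, htu⟩
      exact ⟨s, hs⟩
    obtain ⟨hsJ, hsw, hts⟩ := hs.1
    rcases (hJ s).1 hsJ with hsI | ⟨-, hQ⟩
    · exact (hwlast s hsI hsw).not_gt hts
    refine hQ t ht hts (fun z hz hzs ↦ ?_) hsw
    have hzw := hΩ.lower _ hwΩ hzs.le hsw
    by_contra hzt
    have htz : t < z := ((hΩ.chain _ hwΩ t htw z hzw).resolve_right hzt).lt_of_not_ge hzt
    exact (hs.2 ⟨hz, hzw, htz⟩ hzs.le).not_gt hzs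
  refine ⟨J, hIJ, ⟨hJi, hJX⟩, fun J' ⟨hJ', hJ'X⟩ hJJ' s hsJ' ↦ ?_⟩
  by_contra hsJ
  have hsX := hJ'X hsJ'
  obtain ⟨b₀, hb₀, hsb₀, hlast₀⟩ := hJ'.2 s hsJ'
  have hnot : ¬ ∀ t ∈ J, t < s → (∀ z ∈ J, z < s → z ≤ t) → s ∉ w t := fun h ↦
    hsJ ((hJ s).2 (.inr ⟨⟨hsX, b₀, hb₀, hsb₀, fun z hz ↦ hlast₀ z (hJJ' (hIJ hz))⟩, h⟩))
  push Not at hnot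
  obtain ⟨t, htJ, hts, htmax, hsw⟩ := hnot
  obtain ⟨b, hb, htb, hlast⟩ := hJ'.2 t (hJJ' htJ)
  obtain ⟨hwΩ, htw, hwlast, hcard⟩ := hw t b hb htb fun z hz ↦ hlast z (hJJ' (hIJ hz))
  have hsb : s ∉ b := fun hsb ↦ (hlast s hsJ' hsb).not_gt hts
  -- An element of `X` on `b` but off `w t` lies beyond `t` and has predecessor `t`, so it was
  -- accepted; but `t` is last on `b`. Hence `b` would have been a better choice than `w t`.
  have hsub : X ∩ b ⊆ (X ∩ w t) \ {s} := by
    rintro s' ⟨hs'X, hs'b⟩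
    refine ⟨⟨hs'X, ?_⟩, by rintro rfl; exact hsb hs'b⟩
    by_contra hs'w
    have hts' : t < s' := by
      rcases hΩ.chain b hb t htb s' hs'b with h | h
      · exact h.lt_of_ne (by rintro rfl; exact hs'w htw)
      · exact absurd (hΩ.lower _ hwΩ h htw) hs'w
    have hs'J : s' ∈ J := by
      refine (hJ s').2 (.inr ⟨⟨hs'X, b, hb, hs'b, fun z hz hzb ↦
        (hlast z (hJJ' (hIJ hz)) hzb).trans hts'.le⟩, fun u hu hus' humax ↦ ?_⟩)
      have hut : u ≤ t := hlast u (hJJ' hu) (hΩ.lower b hb hus'.le hs'b)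
      obtain rfl : u = t := hut.antisymm (humax t htJ hts')
      exact hs'w
    exact (hlast s' (hJJ' hs'J) hs'b).not_gt hts'
  have hfin : (X ∩ b).Finite := by
    refine (hΩ.finite _ hwΩ s hsw).subset fun z hz ↦ ?_
    rcases hΩ.chain _ hwΩ z (hsub hz).1.2 s hsw with h | h
    · exact h
    · exact absurd (hΩ.lower b hb h hz.2) hsb
  have hss : X ∩ b ⊂ X ∩ w t :=
    ⟨hsub.trans sdiff_subset, fun h ↦ hsb (h ⟨hsX, hsw⟩).2⟩
  exact (hfin.encard_lt_encard hss).not_ge hcard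

end BranchIndep

/-! ### The branch matroid: cocircuits, tameness, recovery of the branches -/

/-- The matroid of the branch independent subsets of `E`. -/
def branchMatroid [WellFoundedLT α] (E : Set α) (hΩ : IsBranchFamily Ω) : Matroid α :=
  IndepMatroid.matroid
    { E := E
      Indep := BranchIndep E Ω
      indep_empty := BranchIndep.empty
      indep_subset := fun _ _ hJ h ↦ hJ.subset h
      indep_aug := fun _ _ hI hmax hB ↦ hI.augment hΩ hmax hB
      indep_maximal := fun _ hX ↦ BranchIndep.existsMaximalSubsetProperty hΩ hX
      subset_ground := fun _ hI ↦ hI.1 }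

section branchMatroid

variable [WellFoundedLT α] {hΩ : IsBranchFamily Ω}

@[simp] lemma branchMatroid_ground : (branchMatroid E hΩ).E = E := rfl

@[simp] lemma branchMatroid_indep_iff : (branchMatroid E hΩ).Indep J ↔ BranchIndep E Ω J := Iff.rfl

lemma IsBranchCocycle.inter_nonempty (hK : IsBranchCocycle Ω K) (hne : (K ∩ E).Nonempty)
    (hB : (branchMatroid E hΩ).IsBase B) : ((K ∩ E) ∩ B).Nonempty := by
  obtain ⟨x, hxK, hxE⟩ := hne
  obtain ⟨y, hyK, hyB⟩ := BranchIndep.exists_mem_cocycle hΩ hB hK hxK hxE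
  exact ⟨y, ⟨hyK, hB.1.1 hyB⟩, hyB⟩

/-- By minimality, some base `B` meets `K` in `x` only. Exchanging `x` for an element `y` of its
fundamental cocycle gives a base that can meet `K` only in `y`. So the trace of the cocycle lies in
`K`, and equals `K` because it too meets every base. -/
lemma branchMatroid_eq_of_isCocircuit (hK : (branchMatroid E hΩ).IsCocircuit K) :
    ∃ K', IsBranchCocycle Ω K' ∧ K = K' ∩ E := by
  obtain ⟨x, hxK⟩ := hK.nonempty
  rw [Matroid.isCocircuit_iff_minimal] at hK
  obtain ⟨B, hB, hBK⟩ : ∃ B, (branchMatroid E hΩ).IsBase B ∧ ∀ z ∈ B, z ∈ K → z = x := by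
    by_contra! h
    have : x ∈ K \ {x} := hK.2 (fun B hB ↦ by
      obtain ⟨z, hzB, hzK, hzx⟩ := h B hB
      exact ⟨z, ⟨hzK, hzx⟩, hzB⟩) sdiff_subset hxK
    exact this.2 rfl
  obtain ⟨x', hx'K, hx'B⟩ := hK.1 B hB
  obtain rfl := hBK x' hx'B hx'K
  obtain ⟨K', hK', hxK', hall⟩ := BranchIndep.exists_cocycle hΩ (x := x') (I := B \ {x'}) (E := E)
    (by simp) (by rw [insert_sdiff_singleton, insert_eq_of_mem hx'B]; exact hB.1)
  have hsub : K' ∩ E ⊆ K := by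
    intro y hy
    obtain ⟨hyB, hyi⟩ := hall y hy
    have hbase : (branchMatroid E hΩ).IsBase (insert y (B \ {x'})) :=
      Matroid.insert_isBase_of_insert_indep (e := x') (by simp) hyB
        (by rwa [insert_sdiff_singleton, insert_eq_of_mem hx'B]) hyi
    obtain ⟨z, hzK, rfl | hz⟩ := hK.1 _ hbase
    · exact hzK
    · exact (hz.2 (hBK z hz.1 hzK)).elim
  exact ⟨K', hK', subset_antisymm (hK.2 (fun B' hB' ↦
    hK'.inter_nonempty ⟨x', hxK', hB.1.1 hx'B⟩ hB') hsub) hsub⟩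

/-- A circuit contains an `s` beyond which every branch through `s` meets it again. Then `s`
together with the minimal elements of the circuit above `s` is already dependent. These form an
antichain, so a branch contains at most one of them. -/
lemma branchMatroid_isCircuit_inter_finite {C b : Set α} (hC : (branchMatroid E hΩ).IsCircuit C)
    (hb : b ∈ Ω) : (C ∩ b).Finite := by
  obtain ⟨s, hs, hdep⟩ : ∃ s ∈ C, ∀ b ∈ Ω, s ∈ b → ∃ t ∈ C, t ∈ b ∧ s < t := by
    by_contra! h
    refine hC.not_indep ⟨hC.subset_ground, fun s hs ↦ ?_⟩
    obtain ⟨b, hb, hsb, hlast⟩ := h s hs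
    refine ⟨b, hb, hsb, fun t ht htb ↦ ?_⟩
    rcases hΩ.chain b hb s hsb t htb with hst | hts
    · exact (hst.eq_or_lt.resolve_right (hlast t ht htb)).ge
    · exact hts
  let A : Set α := {t | Minimal (fun t ↦ t ∈ C ∧ s < t) t}
  have hA : insert s A = C := by
    refine hC.eq_of_not_indep_subset (fun hI ↦ ?_) (insert_subset hs fun t ht ↦ ht.1.1)
    obtain ⟨b, hb, hsb, hlast⟩ := hI.2 s (mem_insert _ _)
    obtain ⟨t, htC, htb, hst⟩ := hdep b hb hsb
    obtain ⟨u, hut, hu⟩ := exists_minimal_le_of_wellFoundedLT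
      (fun t ↦ t ∈ C ∧ s < t) t ⟨htC, hst⟩
    exact (hlast u (mem_insert_of_mem _ hu) (hΩ.lower b hb hut htb)).not_gt hu.1.2
  have hsub : (A ∩ b).Subsingleton := by
    intro t ht u hu
    rcases hΩ.chain b hb t ht.2 u hu.2 with h | h
    · exact h.antisymm (hu.1.2 ht.1.1 h)
    · exact (ht.1.2 hu.1.1 h).antisymm h
  rw [← hA]
  exact (hsub.finite.insert s).subset (by rw [insert_inter_distrib]; grind)

lemma branchMatroid_isTame : (branchMatroid E hΩ).IsTame := by
  intro C K hC hK
  obtain ⟨K', hK' | ⟨b, hb, c, hc, rfl⟩, rfl⟩ := branchMatroid_eq_of_isCocircuit hK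
  · exact (branchMatroid_isCircuit_inter_finite hC hK').subset (by grind)
  · refine ((branchMatroid_isCircuit_inter_finite hC hb).union
      (branchMatroid_isCircuit_inter_finite hC hc)).subset ?_
    rintro x ⟨hxC, (⟨hx, -⟩ | ⟨hx, -⟩), -⟩
    exacts [.inl ⟨hxC, hx⟩, .inr ⟨hxC, hx⟩]

/-- The branches in an antichain of nonempty branches are determined by the matroid. -/
lemma mem_of_branchMatroid_univ_eq {Ω' : Set (Set α)} {hΩ' : IsBranchFamily Ω'}
    (h : branchMatroid univ hΩ = branchMatroid univ hΩ') {b : Set α} (hb : b ∈ Ω)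
    (hne : b.Nonempty) (hanti : IsAntichain (· ⊆ ·) (insert b Ω')) : b ∈ Ω' := by
  -- A branch of `Ω` meets every base, so it contains a cocircuit, which the other family describes
  -- as a cocycle.
  have hcod : (branchMatroid univ hΩ')✶.Dep b := by
    rw [Matroid.dual_dep_iff_forall]
    refine ⟨fun B hB ↦ ?_, subset_univ _⟩
    rw [← h] at hB
    simpa using IsBranchCocycle.inter_nonempty (.inl hb) (by simpa using hne) hB
  obtain ⟨K, hKb, hK⟩ := hcod.exists_isCircuit_subset
  obtain ⟨K', hK', rfl⟩ := branchMatroid_eq_of_isCocircuit hK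
  rw [inter_univ] at hKb hK
  rcases hK' with hK' | ⟨c, hc, d, hd, rfl⟩
  · rwa [← hanti.eq (mem_insert_of_mem _ hK') (mem_insert _ _) hKb]
  -- The symmetric difference of two incomparable branches is not a chain, so it does not fit into
  -- `b`.
  exfalso
  have hcd : c ≠ d := by
    rintro rfl
    simpa using hK.nonempty
  obtain ⟨x, hxc, hxd⟩ := not_subset.1
    (hanti (mem_insert_of_mem _ hc) (mem_insert_of_mem _ hd) hcd)
  obtain ⟨y, hyd, hyc⟩ := not_subset.1
    (hanti (mem_insert_of_mem _ hd) (mem_insert_of_mem _ hc) hcd.symm)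
  rcases hΩ.chain b hb x (hKb (.inl ⟨hxc, hxd⟩)) y (hKb (.inr ⟨hyd, hyc⟩)) with hxy | hyx
  · exact hxd (hΩ'.lower d hd hxy hyd)
  · exact hyc (hΩ'.lower c hc hyx hxc)

end branchMatroid

/-! ### Minors of branch matroids -/

section branchMatroid

variable [WellFoundedLT α] {hΩ : IsBranchFamily Ω}

open Matroid

lemma branchMatroid_delete (D : Set α) :
    branchMatroid E hΩ ＼ D = branchMatroid (E \ D) hΩ := by
  refine Matroid.ext_indep rfl fun I _ ↦ ?_
  rw [delete_indep_iff, branchMatroid_indep_iff, branchMatroid_indep_iff, BranchIndep, BranchIndep,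
    subset_sdiff]
  tauto

/-- Nothing in `E` lies beyond `s`, so any branch through `s` serves `s`. Once `s` is present, such
a branch serves no other element and can be dropped. -/
lemma branchMatroid_contract_maximal (hs : Maximal (· ∈ E) s) :
    branchMatroid E hΩ ／ {s} =
      branchMatroid (E \ {s}) (hΩ.mono (Ω' := {b ∈ Ω | s ∉ b}) (sep_subset _ _)) := by
  have hlast : ∀ t ∈ E, s ≤ t → t = s := fun t ht hst ↦ (hs.2 ht hst).antisymm hst
  refine Matroid.ext_indep rfl fun I hI ↦ ?_
  have hIE : I ⊆ E := hI.trans sdiff_subset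
  have hsI : s ∉ I := fun h ↦ (hI h).2 rfl
  by_cases hsb : ∃ b ∈ Ω, s ∈ b
  · obtain ⟨b, hb, hsb⟩ := hsb
    have hb_last : ∀ t ∈ E, t ∈ b → t ≤ s := fun t ht htb ↦
      (hΩ.chain b hb t htb s hsb).elim id fun h ↦ (hlast t ht h).le
    have hnl : (branchMatroid E hΩ).IsNonloop s := by
      rw [← indep_singleton]
      exact ⟨by simpa using hs.1, by rintro _ rfl; exact ⟨b, hb, hsb, by simp⟩⟩
    rw [hnl.contractElem_indep_iff, and_iff_right hsI, branchMatroid_indep_iff,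
      branchMatroid_indep_iff]
    refine ⟨fun h ↦ ⟨hI, fun t ht ↦ ?_⟩, fun h ↦ ⟨insert_subset hs.1 hIE, ?_⟩⟩
    · obtain ⟨c, hc, htc, hlastc⟩ := h.2 t (mem_insert_of_mem _ ht)
      refine ⟨c, ⟨hc, fun hsc ↦ hsI ?_⟩, htc, fun z hz ↦ hlastc z (mem_insert_of_mem _ hz)⟩
      rwa [← hlast t (hIE ht) (hlastc s (mem_insert _ _) hsc)]
    · rintro t (rfl | ht)
      · exact ⟨b, hb, hsb, fun z hz ↦ hb_last z (insert_subset hs.1 hIE hz)⟩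
      · obtain ⟨c, ⟨hc, hsc⟩, htc, hlastc⟩ := h.2 t ht
        refine ⟨c, hc, htc, ?_⟩
        rintro z (rfl | hz) hzc
        exacts [absurd hzc hsc, hlastc z hz hzc]
  · have hloop : (branchMatroid E hΩ).IsLoop s := by
      rw [← not_isNonloop_iff (by exact hs.1), ← indep_singleton]
      intro h
      obtain ⟨b, hb, hsb', -⟩ := h.2 s rfl
      exact hsb ⟨b, hb, hsb'⟩
    have hΩs : {b ∈ Ω | s ∉ b} = Ω := by
      ext b
      exact ⟨fun h ↦ h.1, fun h ↦ ⟨h, fun h' ↦ hsb ⟨b, h, h'⟩⟩⟩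
    rw [contract_eq_delete_of_subset_loops (singleton_subset_iff.2 hloop), branchMatroid_delete,
      branchMatroid_indep_iff, branchMatroid_indep_iff, hΩs]

/-- A finite minor of a branch matroid is a contraction of a finite branch matroid. -/
lemma branchMatroid_exists_finite_contract {N : Matroid α} (hN : N ≤m branchMatroid E hΩ)
    (hfin : N.E.Finite) : ∃ (Ω' : Set (Set α)) (hΩ' : IsBranchFamily Ω') (F C : Set α),
      F.Finite ∧ N = branchMatroid F hΩ' ／ C := by
  obtain ⟨C₀, D, -, -, -, rfl⟩ := hN.exists_eq_contract_delete_disjoint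
  -- Contracting a basis of `C₀` and deleting the rest makes the contracted set independent.
  obtain ⟨C, hC⟩ := (branchMatroid E hΩ).exists_isBasis' C₀
  rw [hC.contract_eq_contract_delete, delete_delete] at hfin ⊢
  set D' := C₀ \ C ∪ D
  have hCi := hC.indep
  set F := (branchMatroid E hΩ ／ C ＼ D').E
  have hFE : F ⊆ E := fun x hx ↦ hx.1.1
  have hFC : ∀ x ∈ F, x ∉ C := fun x hx ↦ hx.1.2
  -- Of the contracted elements, only the predecessors of the finitely many remaining elements
  -- matter. The others are encoded in `Ω'`, which keeps a branch only if `P` dominates `C` on it.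
  let P : Set α := {t | t ∈ C ∧ ∃ f ∈ F, t < f ∧ (∃ b ∈ Ω, f ∈ b) ∧ ∀ u ∈ C, u < f → u ≤ t}
  have hPC : P ⊆ C := fun t ht ↦ ht.1
  have hP : P.Finite := by
    choose! g hgF hgt hgb hgmax using fun t (ht : t ∈ P) ↦ ht.2
    refine Finite.of_injOn (fun t ht ↦ hgF t ht) (fun t ht u hu (htu : g t = g u) ↦ ?_) hfin
    exact (hgmax u hu t ht.1 (htu ▸ hgt t ht)).antisymm (hgmax t ht u hu.1 (htu ▸ hgt u hu))
  let Ω' : Set (Set α) := {b ∈ Ω | ∀ t ∈ C, t ∈ b → ∃ u ∈ P, u ∈ b ∧ t ≤ u}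
  have hΩ' : IsBranchFamily Ω' := hΩ.mono (sep_subset _ _)
  have key (I : Set α) (hI : I ⊆ F) : BranchIndep E Ω (I ∪ C) ↔ BranchIndep (F ∪ P) Ω' (I ∪ P) := by
    constructor
    · refine fun h ↦ ⟨union_subset_union_left P hI, fun s hs ↦ ?_⟩
      obtain ⟨b, hb, hsb, hlast⟩ := h.2 s (union_subset_union_right I hPC hs)
      refine ⟨b, ⟨hb, fun t ht htb ↦ ?_⟩, hsb,
        fun t ht ↦ hlast t (union_subset_union_right I hPC ht)⟩
      rcases hs with hs | hs
      · have hlt : ∀ t ∈ C, t ∈ b → t < s := fun t ht htb ↦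
          (hlast t (.inr ht) htb).lt_of_ne (by rintro rfl; exact hFC t (hI hs) ht)
        obtain hno | ⟨u, huC, hus, hu⟩ := hΩ.exists_last_lt hb hsb C
        · exact (hno t ht (hlt t ht htb)).elim
        · exact ⟨u, ⟨huC, s, hI hs, hus, ⟨b, hb, hsb⟩, hu⟩, hΩ.lower b hb hus.le hsb,
            hu t ht (hlt t ht htb)⟩
      · exact ⟨s, hs, hsb, hlast t (.inr ht) htb⟩
    · refine fun h ↦ ⟨union_subset (hI.trans hFE) hCi.1, ?_⟩
      have aux : ∀ s ∈ I ∪ P, ∃ b ∈ Ω, s ∈ b ∧ ∀ t ∈ I ∪ C, t ∈ b → t ≤ s := by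
        intro s hs
        obtain ⟨b, ⟨hb, hbP⟩, hsb, hlast⟩ := h.2 s hs
        refine ⟨b, hb, hsb, ?_⟩
        rintro t (ht | ht) htb
        · exact hlast t (.inl ht) htb
        · obtain ⟨u, hu, hub, htu⟩ := hbP t ht htb
          exact htu.trans (hlast u (.inr hu) hub)
      rintro s (hs | hs)
      · exact aux s (.inl hs)
      by_cases hsP : s ∈ P
      · exact aux s (.inr hsP)
      -- For `s` outside `P` its branch for `C` still works: an element of `I` beyond `s` on it
      -- would have predecessor `s` in `C`.
      obtain ⟨b, hb, hsb, hlast⟩ := hCi.2 s hs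
      refine ⟨b, hb, hsb, ?_⟩
      rintro t (ht | ht) htb
      · by_contra hts
        have hst : s < t := ((hΩ.chain b hb s hsb t htb).resolve_right hts).lt_of_not_ge hts
        exact hsP ⟨hs, t, hI ht, hst, ⟨b, hb, htb⟩, fun u hu hut ↦
          hlast u hu (hΩ.lower b hb hut.le htb)⟩
      · exact hlast t ht htb
  have hPi : (branchMatroid (F ∪ P) hΩ').Indep P := by
    simpa using (key ∅ (empty_subset _)).1 (by simpa using hCi)
  have hFP : Disjoint F P := disjoint_left.2 fun x hx hxP ↦ hFC x hx (hPC hxP)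
  refine ⟨Ω', hΩ', F ∪ P, P, hfin.union hP, Matroid.ext_indep ?_ fun I hI ↦ ?_⟩
  · rw [contract_ground, branchMatroid_ground, union_sdiff_right, hFP.sdiff_eq_left]
  · rw [delete_indep_iff, hCi.contract_indep_iff, hPi.contract_indep_iff, branchMatroid_indep_iff,
      branchMatroid_indep_iff, key I hI, and_iff_right (hFP.mono_left hI),
      and_iff_right (disjoint_left.2 fun x hx ↦ hFC x (hI hx)),
      and_iff_left (disjoint_left.2 fun x hx ↦ (hI hx).2)]

end branchMatroid

end

/-! ### Cycles of multigraphs via paths -/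

namespace Graph

variable {V V' α : Type*} {G : Graph V α} {G' : Graph V' α} {C D : Set α} {U : Set V}
  {x y z : V} {e f : α}

/-- `D` and `U` are the edge set and the vertex set of a path from `x` to `y`. -/
inductive IsPathSet (G : Graph V α) : V → V → Set V → Set α → Prop
  | nil (x : V) : IsPathSet G x x {x} ∅
  | cons {e : α} {x y z : V} {U : Set V} {D : Set α} (he : G.IsLink e x y)
      (h : IsPathSet G y z U D) (hx : x ∉ U) : IsPathSet G x z (insert x U) (insert e D)

namespace IsPathSet

lemma left_mem (h : G.IsPathSet x y U D) : x ∈ U := by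
  cases h <;> simp

lemma right_mem (h : G.IsPathSet x y U D) : y ∈ U := by
  induction h with
  | nil => simp
  | cons _ _ _ ih => exact mem_insert_of_mem _ ih

lemma left_mem_of_isLink (h : G.IsPathSet x y U D) (he : e ∈ D) {u v : V} (hl : G.IsLink e u v) :
    u ∈ U := by
  induction h with
  | nil => simp at he
  | @cons e' x' y' z' U' D' he' h' hx ih =>
    rcases he with rfl | he
    · rcases hl.left_eq_or_eq he' with rfl | rfl
      · exact mem_insert _ _
      · exact mem_insert_of_mem _ h'.left_mem
    · exact mem_insert_of_mem _ (ih he)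

lemma concat (h : G.IsPathSet x y U D) (he : G.IsLink e y z) (hz : z ∉ U) :
    G.IsPathSet x z (insert z U) (insert e D) := by
  induction h with
  | nil x =>
    rw [pair_comm]
    exact .cons he (.nil z) (by simpa [eq_comm] using hz)
  | cons he' h' hx ih =>
    rw [insert_comm, insert_comm e]
    exact .cons he' (ih he (fun h ↦ hz (mem_insert_of_mem _ h)))
      (by rintro (rfl | h); exacts [hz (mem_insert _ _), hx h])

lemma reverse (h : G.IsPathSet x y U D) : G.IsPathSet y x U D := by
  induction h with
  | nil x => exact .nil x
  | cons he h' hx ih => exact ih.concat he.symm hx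

lemma map (h : G.IsPathSet x y U D) (φ : V → V') (hφ : InjOn φ U)
    (hl : ∀ e ∈ D, ∀ u ∈ U, ∀ v ∈ U, G.IsLink e u v → G'.IsLink e (φ u) (φ v)) :
    G'.IsPathSet (φ x) (φ y) (φ '' U) D := by
  induction h with
  | nil x => simpa using IsPathSet.nil (φ x)
  | @cons e' x' y' z' U' D' he' h' hx ih =>
    rw [image_insert_eq]
    refine .cons (hl _ (mem_insert _ _) _ (mem_insert _ _) _ (mem_insert_of_mem _ h'.left_mem) he')
      (ih (hφ.mono (subset_insert _ _)) fun e he u hu v hv ↦ hl e (mem_insert_of_mem _ he) u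
        (mem_insert_of_mem _ hu) v (mem_insert_of_mem _ hv)) ?_
    rintro ⟨u, hu, hux⟩
    exact hx (hφ (mem_insert_of_mem _ hu) (mem_insert _ _) hux ▸ hu)

lemma exists_fin (h : G.IsPathSet x y U D) : ∃ (n : ℕ) (v : Fin (n + 1) → V) (e : Fin n → α),
    v 0 = x ∧ v (Fin.last n) = y ∧ range v = U ∧ range e = D ∧ Function.Injective v ∧
      Function.Injective e ∧ ∀ i : Fin n, G.IsLink (e i) (v i.castSucc) (v i.succ) := by
  induction h with
  | nil x =>
    exact ⟨0, fun _ ↦ x, Fin.elim0, rfl, rfl, by simp, by simp,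
      fun i j _ ↦ Subsingleton.elim (α := Fin 1) i j, fun i ↦ i.elim0, fun i ↦ i.elim0⟩
  | @cons e' x' y' z' U' D' he' h' hx ih =>
    obtain ⟨n, v, e, rfl, rfl, rfl, rfl, hv, he, hl⟩ := ih
    refine ⟨n + 1, Fin.cons x' v, Fin.cons e' e, rfl, rfl, ?_, ?_, ?_, ?_, ?_⟩
    · rw [Fin.range_cons]
    · rw [Fin.range_cons]
    · exact Fin.cons_injective_iff.2 ⟨hx, hv⟩
    · exact Fin.cons_injective_iff.2 ⟨fun h ↦ hx (h'.left_mem_of_isLink h he'), he⟩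
    · intro i
      refine Fin.cases ?_ (fun j ↦ ?_) i
      · exact he'
      · exact hl j

end IsPathSet

lemma isPathSet_of_fin {n : ℕ} {v : Fin (n + 1) → V} {e : Fin n → α} (hv : Function.Injective v)
    (hl : ∀ i : Fin n, G.IsLink (e i) (v i.castSucc) (v i.succ)) :
    G.IsPathSet (v 0) (v (Fin.last n)) (range v) (range e) := by
  induction n with
  | zero =>
    have : range v = {v 0} := by
      ext; simp [Fin.exists_fin_one, eq_comm]
    rw [range_eq_empty e, this]
    exact .nil _
  | succ n ih =>
    have h := ih (v := Fin.tail v) (e := Fin.tail e)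
      (fun i j h ↦ Fin.succ_injective _ (hv h)) (fun i ↦ hl i.succ)
    have hvr : range v = insert (v 0) (range (Fin.tail v)) := by
      rw [← Fin.range_cons, Fin.cons_self_tail]
    have her : range e = insert (e 0) (range (Fin.tail e)) := by
      rw [← Fin.range_cons, Fin.cons_self_tail]
    rw [hvr, her]
    refine .cons (hl 0) h ?_
    rintro ⟨i, hi⟩
    exact Fin.succ_ne_zero i (hv hi)

/-- Cutting a cycle at one of its edges replaces cyclic indices by paths, on which induction is
available. -/
lemma isCycleEdgeSet_and_mem_iff : G.IsCycleEdgeSet C ∧ e ∈ C ↔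
    ∃ x y U D, G.IsLink e x y ∧ G.IsPathSet x y U D ∧ e ∉ D ∧ C = insert e D := by
  constructor
  · rintro ⟨⟨n, v, g, hv, hg, hl, rfl⟩, k, rfl⟩
    -- The indices are rotated so that the edge `g k` becomes the closing one.
    have hp := isPathSet_of_fin (G := G) (v := fun i ↦ v (i + (k + 1)))
      (e := fun i : Fin n ↦ g (i.castSucc + (k + 1)))
      (fun i j h ↦ add_right_cancel (hv h)) (fun i ↦ by
        have := hl (i.castSucc + (k + 1))
        rwa [add_right_comm, Fin.coeSucc_eq_succ] at this)
    have hlast : Fin.last n + (k + 1) = k := by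
      rw [add_comm k, ← add_assoc, Fin.last_add_one, zero_add]
    refine ⟨_, _, _, _, ?_, hp, ?_, ?_⟩
    · simp only [hlast, zero_add]
      exact (hl k).symm
    · rintro ⟨i, hi⟩
      have := hg hi
      nth_rw 2 [← hlast] at this
      exact (Fin.castSucc_lt_last i).ne (add_right_cancel this)
    · ext a
      constructor
      · rintro ⟨i, rfl⟩
        rcases Fin.eq_castSucc_or_eq_last (i - (k + 1)) with ⟨j, hj⟩ | hj
        · refine .inr ⟨j, ?_⟩
          simp only [← hj, sub_add_cancel]
        · left
          rw [← hlast, ← hj, sub_add_cancel]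
      · rintro (rfl | ⟨i, rfl⟩)
        exacts [⟨k, rfl⟩, ⟨_, rfl⟩]
  · rintro ⟨x, y, U, D, he, hp, heD, rfl⟩
    refine ⟨?_, mem_insert _ _⟩
    obtain ⟨n, v, g, rfl, rfl, rfl, rfl, hv, hg, hl⟩ := hp.exists_fin
    refine ⟨n, v, Fin.snoc (α := fun _ ↦ α) g e, hv, Fin.snoc_injective_iff.2 ⟨hg, heD⟩,
      fun i ↦ ?_, by rw [Fin.range_snoc]⟩
    refine Fin.lastCases ?_ (fun j ↦ ?_) i
    · rw [Fin.snoc_last, Fin.last_add_one]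
      exact he.symm
    · rw [Fin.snoc_castSucc, Fin.coeSucc_eq_succ]
      exact hl j

namespace IsCycleEdgeSet

lemma nonempty (h : G.IsCycleEdgeSet C) : C.Nonempty := by
  obtain ⟨n, v, g, -, -, -, rfl⟩ := h
  exact range_nonempty g

lemma subset_edgeSet (h : G.IsCycleEdgeSet C) : C ⊆ G.edgeSet := by
  obtain ⟨n, v, g, -, -, hl, rfl⟩ := h
  rintro _ ⟨i, rfl⟩
  exact (hl i).edge_mem

/-- Injectivity is asked only on ends of edges of `C`, so `φ` may send the vertices off the cycle
anywhere. -/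
lemma map (h : G.IsCycleEdgeSet C) (φ : V → V')
    (hφ : ∀ e ∈ C, ∀ f ∈ C, ∀ x y, G.Inc e x → G.Inc f y → φ x = φ y → x = y)
    (hl : ∀ e ∈ C, ∀ x y, G.IsLink e x y → G'.IsLink e (φ x) (φ y)) : G'.IsCycleEdgeSet C := by
  obtain ⟨n, v, g, hv, hg, hlk, rfl⟩ := h
  refine ⟨n, φ ∘ v, g, fun i j hij ↦ hv ?_, hg, fun i ↦ hl _ ⟨i, rfl⟩ _ _ (hlk i), rfl⟩
  exact hφ _ ⟨i, rfl⟩ _ ⟨j, rfl⟩ _ _ (hlk i).inc_left (hlk j).inc_left hij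

lemma image_edges (h : G.IsCycleEdgeSet C) {φ : α → α} (hφ : Function.Injective φ)
    (hl : ∀ e ∈ C, ∀ x y, G.IsLink e x y → G.IsLink (φ e) x y) :
    G.IsCycleEdgeSet (φ '' C) := by
  obtain ⟨n, v, g, hv, hg, hlk, rfl⟩ := h
  exact ⟨n, v, φ ∘ g, hv, hφ.comp hg, fun i ↦ hl _ ⟨i, rfl⟩ _ _ (hlk i), range_comp φ g⟩

lemma eq_singleton_of_isLoopAt (h : G.IsCycleEdgeSet C) (he : e ∈ C) (hl : G.IsLink e x x) :
    C = {e} := by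
  obtain ⟨u, v, U, D, hel, hp, heD, rfl⟩ := isCycleEdgeSet_and_mem_iff.1 ⟨h, he⟩
  have huv : u = v := by
    rcases hl.eq_and_eq_or_eq_and_eq hel with ⟨h, h'⟩ | ⟨h, h'⟩ <;> exact (by rw [← h, ← h'])
  subst huv
  cases hp with
  | nil => simp
  | cons _ h' hx => exact (hx h'.right_mem).elim

/-- A cycle that passes through a vertex along a nonloop edge leaves it along another edge. -/
lemma exists_ne_inc (h : G.IsCycleEdgeSet C) (he : e ∈ C) (hl : G.IsLink e x y) (hxy : x ≠ y) :
    ∃ f ∈ C, f ≠ e ∧ G.Inc f x := by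
  obtain ⟨u, v, U, D, hel, hp, heD, rfl⟩ := isCycleEdgeSet_and_mem_iff.1 ⟨h, he⟩
  have key : ∀ u v, G.IsPathSet u v U D → u ≠ v → ∃ f ∈ insert e D, f ≠ e ∧ G.Inc f u := by
    intro u v hp huv
    cases hp with
    | nil => exact (huv rfl).elim
    | @cons f _ _ _ _ _ hf =>
      exact ⟨f, by simp, by rintro rfl; simp at heD, hf.inc_left⟩
  rcases hl.eq_and_eq_or_eq_and_eq hel with ⟨rfl, rfl⟩ | ⟨rfl, rfl⟩
  · exact key _ _ hp hxy
  · exact key _ _ hp.reverse hxy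

lemma eq_pair (h : G.IsCycleEdgeSet C) (he : e ∈ C) (hf : f ∈ C) (hef : e ≠ f)
    (hle : G.IsLink e x y) (hlf : G.IsLink f x y) : C = {e, f} := by
  have hxy : x ≠ y := by
    rintro rfl
    have := h.eq_singleton_of_isLoopAt he hle
    rw [this] at hf
    exact hef hf.symm
  obtain ⟨u, v, U, D, hel, hp, heD, rfl⟩ := isCycleEdgeSet_and_mem_iff.1 ⟨h, he⟩
  have hfD : f ∈ D := hf.resolve_left hef.symm
  have hflink : G.IsLink f u v ∧ u ≠ v := by
    rcases hle.eq_and_eq_or_eq_and_eq hel with ⟨rfl, rfl⟩ | ⟨rfl, rfl⟩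
    exacts [⟨hlf, hxy⟩, ⟨hlf.symm, hxy.symm⟩]
  cases hp with
  | nil => exact (hflink.2 rfl).elim
  | @cons g _ w _ U' D' hg h' hu =>
    rcases hfD with rfl | hfD
    · obtain rfl := hg.right_unique hflink.1
      cases h' with
      | nil => simp
      | cons _ h'' hx => exact (hx h''.right_mem).elim
    · exact (hu (h'.left_mem_of_isLink hfD hflink.1)).elim

end IsCycleEdgeSet

lemma isCycleEdgeSet_singleton (he : G.IsLink e x x) : G.IsCycleEdgeSet {e} :=
  (isCycleEdgeSet_and_mem_iff.2 ⟨x, x, {x}, ∅, he, .nil x, by simp, by simp⟩).1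

lemma isCycleEdgeSet_pair (he : G.IsLink e x y) (hf : G.IsLink f x y) (hxy : x ≠ y)
    (hef : e ≠ f) : G.IsCycleEdgeSet {e, f} :=
  (isCycleEdgeSet_and_mem_iff.2 ⟨x, y, {x, y}, {f}, he,
    by simpa using IsPathSet.cons hf (.nil y) (by simpa using hxy), by simpa using hef, rfl⟩).1

/-- The graph in which every edge `e` in `E` joins `a e` and `b e`. -/
@[simps] def ofEnds (E : Set α) (a b : α → V) : Graph V α where
  vertexSet := univ
  edgeSet := E
  IsLink e x y := e ∈ E ∧ (a e = x ∧ b e = y ∨ a e = y ∧ b e = x)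
  isLink_symm e _ := ⟨fun x y h ↦ ⟨h.1, h.2.symm⟩⟩
  eq_or_eq_of_isLink_of_isLink := by grind
  edge_mem_iff_exists_isLink e := ⟨fun he ↦ ⟨a e, b e, he, .inl ⟨rfl, rfl⟩⟩, fun ⟨_, _, h⟩ ↦ h.1⟩
  left_mem_of_isLink _ _ _ _ := mem_univ _

variable {E : Set α} {a b : α → V}

lemma ofEnds_inc : (ofEnds E a b).Inc e x ↔ e ∈ E ∧ (a e = x ∨ b e = x) := by
  simp only [Inc, ofEnds_isLink]
  grind

lemma ofEnds_isLink_self (he : e ∈ E) : (ofEnds E a b).IsLink e (a e) (b e) := by simp [he]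

end Graph

/-! ### Lens drawings and operations on them -/

/-- The closed lens with tips `(0, 0)` and `(1, 0)`, without its tips. -/
def lensInterior : Set (ℝ × ℝ) := {p | 0 < p.1 ∧ p.1 < 1 ∧ |p.2| ≤ p.1 * (1 - p.1)}

/-- The closed lens with tips `(0, 0)` and `(1, 0)`. -/
def closedLens : Set (ℝ × ℝ) := {p | 0 ≤ p.1 ∧ p.1 ≤ 1 ∧ |p.2| ≤ p.1 * (1 - p.1)}

/-- A drawing of the graph in which every edge `e` in `E` joins `a e` and `b e`, where every edge is
represented by a lens and everything is drawn to the left of some vertical line. -/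
structure LensDrawing {V α : Type*} (E : Set α) (a b : α → V) where
  point : V → ℝ × ℝ
  lens : α → ℝ × ℝ → ℝ × ℝ
  bound : ℝ
  point_injective : Function.Injective point
  point_lt : ∀ x, (point x).1 < bound
  continuousOn : ∀ e ∈ E, ContinuousOn (lens e) closedLens
  injOn : ∀ e ∈ E, InjOn (lens e) lensInterior
  left : ∀ e ∈ E, lens e (0, 0) = point (a e)
  right : ∀ e ∈ E, lens e (1, 0) = point (b e)
  ne_point : ∀ e ∈ E, ∀ p ∈ lensInterior, ∀ x, lens e p ≠ point x
  disjoint : ∀ e ∈ E, ∀ f ∈ E, e ≠ f → ∀ p ∈ lensInterior, ∀ q ∈ lensInterior,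
    lens e p ≠ lens f q
  lens_lt : ∀ e ∈ E, ∀ p ∈ lensInterior, (lens e p).1 < bound

namespace LensDrawing

variable {V V' α : Type*} {E : Set α} {a b : α → V} {a' b' : α → V} {e f : α}

open Graph

/-- The arcs of a lens drawing are the axes of the lenses. -/
def planeDrawing (d : LensDrawing E a b) : (ofEnds E a b).PlaneDrawing where
  point := d.point
  arc e t := d.lens e (t, 0)
  point_injOn := d.point_injective.injOn
  arc_continuousOn e he := (d.continuousOn e he).comp (by fun_prop) fun t ht ↦
    ⟨ht.1, ht.2, by simpa using mul_nonneg ht.1 (sub_nonneg.2 ht.2)⟩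
  arc_injOn e he s hs t ht h := congrArg Prod.fst (d.injOn e he
    ⟨hs.1, hs.2, by simpa using mul_nonneg hs.1.le (sub_nonneg.2 hs.2.le)⟩
    ⟨ht.1, ht.2, by simpa using mul_nonneg ht.1.le (sub_nonneg.2 ht.2.le)⟩ h)
  arc_ends e he := ⟨a e, b e, ofEnds_isLink_self he, d.left e he, d.right e he⟩
  arc_ne_point e he t ht x _ := d.ne_point e he _
    ⟨ht.1, ht.2, by simpa using mul_nonneg ht.1.le (sub_nonneg.2 ht.2.le)⟩ x
  arc_disjoint e he f hf hef := by
    rw [Set.disjoint_left]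
    rintro _ ⟨s, hs, rfl⟩ ⟨t, ht, hst⟩
    exact d.disjoint e he f hf hef _
      ⟨hs.1, hs.2, by simpa using mul_nonneg hs.1.le (sub_nonneg.2 hs.2.le)⟩ _
      ⟨ht.1, ht.2, by simpa using mul_nonneg ht.1.le (sub_nonneg.2 ht.2.le)⟩ hst.symm

/-- The drawing of the graph with one vertex and no edges. -/
def ofEmptyEdges (a b : α → Unit) : LensDrawing (∅ : Set α) a b where
  point _ := 0
  lens _ := id
  bound := 1
  point_injective _ _ _ := rfl
  point_lt _ := zero_lt_one
  continuousOn := by simp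
  injOn := by simp
  left := by simp
  right := by simp
  ne_point := by simp
  disjoint := by simp
  lens_lt := by simp

/-- Two ways to draw an edge near the origin: as a loop at the origin, or as an edge that joins the
origin to `(1, 0)`. -/
def pendantLens (i : Bool) (p : ℝ × ℝ) : ℝ × ℝ :=
  if i then p else
    (p.1 * (1 - p.1) * (1 + p.2), p.1 * (1 - p.1) * (1 + p.2) * (2 * p.1 - 1))

/-- Since `p.1 * (1 - p.1)` is at most `1 / 4`, so is `|p.2|`. This keeps the loop strictly to the
right of its vertex and to the left of the next one. -/
lemma one_add_pos_of_mem_lensInterior {p : ℝ × ℝ} (hp : p ∈ lensInterior) :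
    0 < p.1 * (1 - p.1) * (1 + p.2) ∧ p.1 * (1 - p.1) * (1 + p.2) < 1 := by
  obtain ⟨h0, h1, h2⟩ := hp
  rw [abs_le] at h2
  have h3 : 0 < p.1 * (1 - p.1) := mul_pos h0 (sub_pos.2 h1)
  have h4 : p.1 * (1 - p.1) ≤ 1 / 4 := by nlinarith [sq_nonneg (2 * p.1 - 1)]
  constructor
  · exact mul_pos h3 (by linarith)
  · nlinarith

/-- Add a new component with two vertices and one edge, which is a loop or joins the vertices. -/
noncomputable def addComponent (d : LensDrawing E a b) (i : Bool) (he : e ∉ E) {a' b' : α → V ⊕ Bool}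
    (ha : ∀ f ∈ E, a' f = .inl (a f)) (hb : ∀ f ∈ E, b' f = .inl (b f))
    (hae : a' e = .inr false) (hbe : b' e = .inr i) : LensDrawing (insert e E) a' b' where
  point := Sum.elim d.point fun j ↦ (d.bound + if j then 1 else 0, 0)
  lens f := open Classical in
    if f = e then fun p ↦ (d.bound + (pendantLens i p).1, (pendantLens i p).2) else d.lens f
  -- The new vertices are at distance 0 and 1 from the old bound, and the new lens lies strictly
  -- between them.
  bound := d.bound + 2
  point_injective := by
    rintro (x | x) (y | y) h
    · rw [d.point_injective h]
    · have := d.point_lt x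
      have h' := congrArg Prod.fst h
      simp only [Sum.elim_inl, Sum.elim_inr] at h'
      split_ifs at h' <;> linarith
    · have := d.point_lt y
      have h' := congrArg Prod.fst h
      simp only [Sum.elim_inl, Sum.elim_inr] at h'
      split_ifs at h' <;> linarith
    · have h' := congrArg Prod.fst h
      simp only [Sum.elim_inr] at h'
      cases x <;> cases y <;> simp_all
  point_lt := by
    rintro (x | x)
    · have := d.point_lt x
      simp only [Sum.elim_inl]
      linarith
    · simp only [Sum.elim_inr]
      split_ifs <;> linarith
  continuousOn := by
    rintro f (rfl | hf)
    · rw [if_pos rfl]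
      refine Continuous.continuousOn ?_
      unfold pendantLens
      cases i <;> simp only [Bool.false_eq_true, if_true, if_false] <;> fun_prop
    · rw [if_neg (by rintro rfl; exact he hf)]
      exact d.continuousOn f hf
  injOn := by
    rintro f (rfl | hf)
    · rw [if_pos rfl]
      intro p hp q hq hpq
      obtain ⟨h1, h2⟩ := Prod.mk.inj hpq
      have h1' := add_left_cancel h1
      cases i
      · simp only [pendantLens, Bool.false_eq_true, if_false] at h1' h2
        -- The quotient of the two coordinates is `2 * p.1 - 1`, which gives back `p.1` and then
        -- `p.2`.
        have hp' := (one_add_pos_of_mem_lensInterior hp).1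
        rw [h1'] at h2 hp'
        have h3 := mul_left_cancel₀ hp'.ne' h2
        have h4 : p.1 = q.1 := by linarith
        have h5 : (0 : ℝ) < q.1 * (1 - q.1) := mul_pos hq.1 (sub_pos.2 hq.2.1)
        rw [h4] at h1'
        have h6 := mul_left_cancel₀ h5.ne' h1'
        exact Prod.ext h4 (by linarith)
      · exact Prod.ext h1' h2
    · rw [if_neg (by rintro rfl; exact he hf)]
      exact d.injOn f hf
  left := by
    rintro f (rfl | hf)
    · cases i <;> simp [hae, pendantLens]
    · rw [if_neg (by rintro rfl; exact he hf), ha f hf]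
      exact d.left f hf
  right := by
    rintro f (rfl | hf)
    · cases i <;> simp [hbe, pendantLens]
    · rw [if_neg (by rintro rfl; exact he hf), hb f hf]
      exact d.right f hf
  ne_point := by
    rintro f (rfl | hf) p hp
    · rw [if_pos rfl]
      have hpos : 0 < (pendantLens i p).1 ∧ (pendantLens i p).1 < 1 := by
        cases i
        · exact one_add_pos_of_mem_lensInterior hp
        · exact ⟨hp.1, hp.2.1⟩
      rintro (x | x) h
      · have := d.point_lt x
        have h' := congrArg Prod.fst h
        simp only [Sum.elim_inl] at h'
        linarith
      · have h' := congrArg Prod.fst h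
        simp only [Sum.elim_inr] at h'
        split_ifs at h' <;> linarith
    · rw [if_neg (by rintro rfl; exact he hf)]
      rintro (x | x) h
      · exact d.ne_point f hf p hp x h
      · have := d.lens_lt f hf p hp
        have h' := congrArg Prod.fst h
        simp only [Sum.elim_inr] at h'
        split_ifs at h' <;> linarith
  disjoint := by
    have key : ∀ f ∈ E, ∀ p ∈ lensInterior, ∀ q ∈ lensInterior,
        d.lens f p ≠ (d.bound + (pendantLens i q).1, (pendantLens i q).2) := by
      intro f hf p hp q hq h
      have hpos : 0 < (pendantLens i q).1 := by
        cases i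
        · exact (one_add_pos_of_mem_lensInterior hq).1
        · exact hq.1
      have := d.lens_lt f hf p hp
      rw [h] at this
      simp only at this
      linarith
    rintro f (rfl | hf) g (rfl | hg) hfg p hp q hq
    · exact (hfg rfl).elim
    · rw [if_pos rfl, if_neg hfg.symm]
      exact (key g hg q hq p hp).symm
    · rw [if_pos rfl, if_neg hfg]
      exact key f hf p hp q hq
    · rw [if_neg (by rintro rfl; exact he hf), if_neg (by rintro rfl; exact he hg)]
      exact d.disjoint f hf g hg hfg p hp q hq
  lens_lt := by
    rintro f (rfl | hf) p hp
    · rw [if_pos rfl]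
      have hpos : (pendantLens i p).1 < 1 := by
        cases i
        · exact (one_add_pos_of_mem_lensInterior hp).2
        · exact hp.2.1
      linarith
    · rw [if_neg (by rintro rfl; exact he hf)]
      linarith [d.lens_lt f hf p hp]

/-- The lens is divided into an upper lens, for `σ = 1`, and a lower one, for `σ = -1`. -/
noncomputable def sublens (σ : ℝ) (p : ℝ × ℝ) : ℝ × ℝ :=
  (p.1, p.2 / 3 + σ * (p.1 * (1 - p.1) / 2))

/-- The part fits because `1 / 3 + 1 / 2 ≤ 1`. -/
lemma sublens_mem_closedLens {σ : ℝ} (hσ : |σ| ≤ 1) {p : ℝ × ℝ} (hp : p ∈ closedLens) :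
    sublens σ p ∈ closedLens := by
  obtain ⟨h0, h1, h2⟩ := hp
  refine ⟨h0, h1, ?_⟩
  have h3 : 0 ≤ p.1 * (1 - p.1) := mul_nonneg h0 (sub_nonneg.2 h1)
  rw [abs_le] at h2 hσ ⊢
  simp only [sublens]
  constructor <;> nlinarith

lemma sublens_mem_lensInterior {σ : ℝ} (hσ : |σ| ≤ 1) {p : ℝ × ℝ} (hp : p ∈ lensInterior) :
    sublens σ p ∈ lensInterior :=
  ⟨hp.1, hp.2.1, (sublens_mem_closedLens hσ (p := p) ⟨hp.1.le, hp.2.1.le, hp.2.2⟩).2.2⟩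

lemma sublens_injective (σ : ℝ) : Function.Injective (sublens σ) := by
  rintro ⟨p, p'⟩ ⟨q, q'⟩ h
  obtain ⟨rfl, h2⟩ := Prod.mk.inj h
  simp only at h2
  exact Prod.ext rfl (by simp only; linarith)

/-- As `1 / 3 < 1 / 2`, the axis separates the two parts. -/
lemma sublens_ne {p q : ℝ × ℝ} (hp : p ∈ lensInterior) (hq : q ∈ lensInterior) :
    sublens 1 p ≠ sublens (-1) q := by
  obtain ⟨p, p'⟩ := p
  obtain ⟨q, q'⟩ := q
  intro h
  obtain ⟨rfl, h2⟩ := Prod.mk.inj h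
  obtain ⟨h0, h1, hp2⟩ := hp
  have hq2 := hq.2.2
  have h3 : 0 < p * (1 - p) := mul_pos h0 (sub_pos.2 h1)
  rw [abs_le] at hp2 hq2
  simp only at *
  linarith

/-- Replace lenses by parts of lenses: the edge `e` of the new graph runs through the part `T e` of
the lens of the edge `o e` of the old graph. -/
def refine (d : LensDrawing E a b) {E' : Set α} {a' b' : α → V'} (o : α → α)
    (T : α → ℝ × ℝ → ℝ × ℝ) (point : V' → ℝ × ℝ) (ho : ∀ e ∈ E', o e ∈ E)
    (hT : ∀ e ∈ E', Continuous (T e) ∧ Function.Injective (T e) ∧ MapsTo (T e) closedLens closedLens ∧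
      MapsTo (T e) lensInterior lensInterior)
    (hTd : ∀ e ∈ E', ∀ f ∈ E', e ≠ f → o e = o f → ∀ p ∈ lensInterior, ∀ q ∈ lensInterior,
      T e p ≠ T f q)
    (hpoint : Function.Injective point)
    (hpoint' : ∀ x, point x ∈ range d.point ∨
      ∃ e ∈ E, ∃ q ∈ lensInterior, point x = d.lens e q ∧
        ∀ f ∈ E', o f = e → ∀ p ∈ lensInterior, T f p ≠ q)
    (hleft : ∀ e ∈ E', d.lens (o e) (T e (0, 0)) = point (a' e))
    (hright : ∀ e ∈ E', d.lens (o e) (T e (1, 0)) = point (b' e)) : LensDrawing E' a' b' where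
  point := point
  lens e p := d.lens (o e) (T e p)
  bound := d.bound
  point_injective := hpoint
  point_lt x := by
    obtain ⟨y, hy⟩ | ⟨e, he, q, hq, hx, -⟩ := hpoint' x
    · rw [← hy]
      exact d.point_lt y
    · rw [hx]
      exact d.lens_lt e he q hq
  continuousOn e he := (d.continuousOn _ (ho e he)).comp (hT e he).1.continuousOn (hT e he).2.2.1
  injOn e he := (d.injOn _ (ho e he)).comp (hT e he).2.1.injOn (hT e he).2.2.2
  left := hleft
  right := hright
  ne_point e he p hp x := by
    obtain ⟨y, hy⟩ | ⟨f, hf, q, hq, hx, hq'⟩ := hpoint' x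
    · rw [← hy]
      exact d.ne_point _ (ho e he) _ ((hT e he).2.2.2 hp) y
    · rw [hx]
      intro h
      by_cases hef : o e = f
      · subst hef
        exact hq' e he rfl p hp (d.injOn _ hf ((hT e he).2.2.2 hp) hq h)
      · exact d.disjoint _ (ho e he) _ hf hef _ ((hT e he).2.2.2 hp) _ hq h
  disjoint e he f hf hef p hp q hq h := by
    by_cases hef' : o e = o f
    · rw [← hef'] at h
      exact hTd e he f hf hef hef' p hp q hq
        (d.injOn _ (ho e he) ((hT e he).2.2.2 hp) ((hT f hf).2.2.2 hq) h)
    · exact d.disjoint _ (ho e he) _ (ho f hf) hef' _ ((hT e he).2.2.2 hp) _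
        ((hT f hf).2.2.2 hq) h
  lens_lt e he p hp := d.lens_lt _ (ho e he) _ ((hT e he).2.2.2 hp)

/-- Add an edge `e` parallel to `f`. -/
noncomputable def addParallel (d : LensDrawing E a b) (he : e ∉ E) (hf : f ∈ E)
    (ha : ∀ g ∈ E, a' g = a g) (hb : ∀ g ∈ E, b' g = b g) (hae : a' e = a f) (hbe : b' e = b f) :
    LensDrawing (insert e E) a' b' := by
  classical
  refine d.refine (fun g ↦ if g = e then f else g)
    (fun g ↦ if g = e then sublens 1 else if g = f then sublens (-1) else id) d.point
    ?_ ?_ ?_ d.point_injective (fun x ↦ .inl ⟨x, rfl⟩) ?_ ?_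
  · grind
  · intro g hg
    have h1 : ∀ σ : ℝ, |σ| ≤ 1 → Continuous (sublens σ) ∧ Function.Injective (sublens σ) ∧
      MapsTo (sublens σ) closedLens closedLens ∧ MapsTo (sublens σ) lensInterior lensInterior :=
      fun σ hσ ↦ ⟨by unfold sublens; fun_prop, sublens_injective σ,
        fun p hp ↦ sublens_mem_closedLens hσ hp, fun p hp ↦ sublens_mem_lensInterior hσ hp⟩
    split_ifs
    · exact h1 1 (by norm_num)
    · exact h1 (-1) (by norm_num)
    · exact ⟨continuous_id, Function.injective_id, mapsTo_id _, mapsTo_id _⟩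
  · intro g hg h hh hgh ho p hp q hq
    have h1 := sublens_ne hp hq
    have h2 := sublens_ne hq hp
    grind
  · rintro g (rfl | hg)
    · simpa [sublens, hae] using d.left f hf
    · rw [ha g hg, ← d.left g hg]
      have : g ≠ e := by rintro rfl; exact he hg
      by_cases hgf : g = f <;> simp_all [sublens]
  · rintro g (rfl | hg)
    · simpa [sublens, hbe] using d.right f hf
    · rw [hb g hg, ← d.right g hg]
      have : g ≠ e := by rintro rfl; exact he hg
      by_cases hgf : g = f <;> simp_all [sublens]

/-- The lens contains a left lens, for `c = 0`, and a right one, for `c = 1 / 2`. -/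
noncomputable def halfLens (c : ℝ) (p : ℝ × ℝ) : ℝ × ℝ := (p.1 / 2 + c, p.2 / 2)

lemma halfLens_bound {c : ℝ} (hc : c = 0 ∨ c = 1 / 2) {p : ℝ × ℝ} (h0 : 0 ≤ p.1) (h1 : p.1 ≤ 1)
    (h2 : |p.2| ≤ p.1 * (1 - p.1)) :
    |(halfLens c p).2| ≤ (halfLens c p).1 * (1 - (halfLens c p).1) := by
  rw [abs_le] at h2 ⊢
  simp only [halfLens]
  rcases hc with rfl | rfl <;> constructor <;> nlinarith

/-- Subdivide the edge `f`; its second half is the new edge `e`. -/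
noncomputable def subdivide (d : LensDrawing E a b) (he : e ∉ E) (hf : f ∈ E)
    {a' b' : α → Option V}
    (ha : ∀ g ∈ E, a' g = some (a g)) (hb : ∀ g ∈ E, g ≠ f → b' g = some (b g))
    (hbf : b' f = none) (hae : a' e = none) (hbe : b' e = some (b f)) :
    LensDrawing (insert e E) a' b' := by
  classical
  have hfe : f ≠ e := by rintro rfl; exact he hf
  have hm : ((1 / 2, 0) : ℝ × ℝ) ∈ lensInterior := by
    refine ⟨?_, ?_, ?_⟩ <;> norm_num
  refine d.refine (fun g ↦ if g = e then f else g)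
    (fun g ↦ if g = e then halfLens (1 / 2) else if g = f then halfLens 0 else id)
    -- The subdividing vertex is the image of the centre of the lens, which is the common tip of the
    -- two half lenses.
    (fun x ↦ x.elim (d.lens f (1 / 2, 0)) d.point) ?_ ?_ ?_ ?_ ?_ ?_ ?_
  · grind
  · intro g hg
    have h1 : ∀ c : ℝ, c = 0 ∨ c = 1 / 2 → Continuous (halfLens c) ∧
        Function.Injective (halfLens c) ∧ MapsTo (halfLens c) closedLens closedLens ∧
        MapsTo (halfLens c) lensInterior lensInterior := by
      refine fun c hc ↦ ⟨by unfold halfLens; fun_prop, ?_, ?_, ?_⟩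
      · rintro ⟨p, p'⟩ ⟨q, q'⟩ h
        obtain ⟨h1, h2⟩ := Prod.mk.inj h
        simp only at h1 h2
        exact Prod.ext (by simp only; linarith) (by simp only; linarith)
      · rintro p ⟨h0, h1, h2⟩
        refine ⟨?_, ?_, halfLens_bound hc h0 h1 h2⟩ <;> simp only [halfLens] <;>
          rcases hc with rfl | rfl <;> linarith
      · rintro p ⟨h0, h1, h2⟩
        refine ⟨?_, ?_, halfLens_bound hc h0.le h1.le h2⟩ <;> simp only [halfLens] <;>
          rcases hc with rfl | rfl <;> linarith
    split_ifs
    · exact h1 _ (.inr rfl)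
    · exact h1 _ (.inl rfl)
    · exact ⟨continuous_id, Function.injective_id, mapsTo_id _, mapsTo_id _⟩
  · intro g hg h hh hgh ho p hp q hq
    have key : ∀ p ∈ lensInterior, ∀ q ∈ lensInterior, halfLens 0 p ≠ halfLens (1 / 2) q := by
      intro p hp q hq h
      have h1 := congrArg Prod.fst h
      have h2 := hp.2.1
      have h3 := hq.1
      simp only [halfLens] at h1
      linarith
    have h1 := key p hp q hq
    have h2 := key q hq p hp
    grind
  · rintro (_ | x) (_ | y) h
    · rfl
    · exact (d.ne_point f hf _ hm y h).elim
    · exact (d.ne_point f hf _ hm x h.symm).elim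
    · rw [d.point_injective h]
  · rintro (_ | x)
    · refine .inr ⟨f, hf, (1 / 2, 0), hm, rfl, fun g hg hgf p hp h ↦ ?_⟩
      have hp0 := hp.1
      have hp1 := hp.2.1
      by_cases hge : g = e
      · have h1 := congrArg Prod.fst h
        simp only [if_pos hge, halfLens] at h1
        linarith
      · rw [if_neg hge] at hgf
        have h1 := congrArg Prod.fst h
        simp only [if_neg hge, if_pos hgf, halfLens] at h1
        linarith
    · exact .inl ⟨x, rfl⟩
  · rintro g (rfl | hg)
    · simp [halfLens, hae]
    · rw [ha g hg]
      have hge : g ≠ e := by rintro rfl; exact he hg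
      by_cases hgf : g = f
      · subst hgf
        simpa [hge, halfLens] using d.left g hg
      · simpa [hge, hgf] using d.left g hg
  · rintro g (rfl | hg)
    · simp only [if_true, hbe, halfLens]
      norm_num
      exact d.right f hf
    · have hge : g ≠ e := by rintro rfl; exact he hg
      by_cases hgf : g = f
      · subst hgf
        simp [hge, halfLens, hbf]
      · simpa [hge, hgf, hb g hg hgf] using d.right g hg

end LensDrawing

/-! ### Extending a drawn cycle matroid by one element -/

namespace Matroid

variable {α : Type*} {M : Matroid α} {C : Set α} {e f : α}

open Graph

/-- `M` is the cycle matroid of a finite graph that has a lens drawing. -/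
def IsLensGraphic (M : Matroid α) : Prop :=
  ∃ (V : Type) (_ : Finite V) (a b : α → V), Nonempty (LensDrawing M.E a b) ∧
    ∀ C, M.IsCircuit C ↔ (ofEnds M.E a b).IsCycleEdgeSet C

lemma IsLensGraphic.isFinitePlanar (h : M.IsLensGraphic) (hM : M.E.Finite) :
    M.IsFinitePlanar := by
  obtain ⟨V, _, a, b, ⟨d⟩, hC⟩ := h
  exact ⟨hM, V, ofEnds M.E a b, toFinite _, ⟨d.planeDrawing⟩, rfl, hC⟩

lemma isLensGraphic_of_ground_eq_empty (h : M.E = ∅) : M.IsLensGraphic := by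
  refine ⟨Unit, inferInstance, fun _ ↦ (), fun _ ↦ (), ?_⟩
  rw [h]
  refine ⟨⟨LensDrawing.ofEmptyEdges _ _⟩, fun C ↦ iff_of_false (fun hC ↦ ?_) fun hC ↦ ?_⟩
  · exact hC.nonempty.ne_empty (subset_empty_iff.1 (h ▸ hC.subset_ground))
  · exact hC.nonempty.ne_empty (subset_empty_iff.1 hC.subset_edgeSet)

lemma delete_singleton_ground (he : e ∈ M.E) : M.E = insert e (M ＼ {e}).E := by
  rw [delete_ground, insert_sdiff_singleton, insert_eq_of_mem he]

/-- A graph stays the same in all other components if one adds a component with one edge. -/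
lemma isCycleEdgeSet_ofEnds_addComponent {V : Type*} {E : Set α} {a b : α → V}
    {a' b' : α → V ⊕ Bool} (heC : e ∉ C) (ha : ∀ f ∈ E, a' f = .inl (a f))
    (hb : ∀ f ∈ E, b' f = .inl (b f)) :
    (ofEnds (insert e E) a' b').IsCycleEdgeSet C ↔ (ofEnds E a b).IsCycleEdgeSet C := by
  constructor
  · intro h
    have hCE : C ⊆ E := fun f hf ↦ (h.subset_edgeSet hf).resolve_left fun hfe ↦ heC (hfe ▸ hf)
    obtain ⟨f, hf⟩ := h.nonempty
    -- The cycle avoids the new component, so the value on it is arbitrary.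
    refine h.map (Sum.elim id fun _ ↦ a f) ?_ ?_
    · intro f hf g hg x y hx hy hxy
      simp only [ofEnds_inc, ha f (hCE hf), hb f (hCE hf), ha g (hCE hg), hb g (hCE hg)] at hx hy
      obtain ⟨-, rfl | rfl⟩ := hx <;> obtain ⟨-, rfl | rfl⟩ := hy <;> simpa using hxy
    · rintro f hf x y ⟨-, h⟩
      rw [ha f (hCE hf), hb f (hCE hf)] at h
      refine ⟨hCE hf, ?_⟩
      obtain ⟨rfl, rfl⟩ | ⟨rfl, rfl⟩ := h <;> simp
  · intro h
    have hCE : C ⊆ E := h.subset_edgeSet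
    refine h.map Sum.inl (fun _ _ _ _ _ _ _ _ h ↦ Sum.inl_injective h) ?_
    rintro f hf x y ⟨-, h⟩
    refine ⟨.inr (hCE hf), ?_⟩
    rw [ha f (hCE hf), hb f (hCE hf)]
    simpa using h

open Classical in
lemma IsLensGraphic.of_delete_isLoop (h : (M ＼ {e}).IsLensGraphic) (he : M.IsLoop e) :
    M.IsLensGraphic := by
  obtain ⟨V, _, a, b, ⟨d⟩, hC⟩ := h
  have heE : e ∉ (M ＼ {e}).E := by simp
  let a' : α → V ⊕ Bool := Function.update (.inl ∘ a) e (.inr false)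
  let b' : α → V ⊕ Bool := Function.update (.inl ∘ b) e (.inr false)
  have hne : ∀ f ∈ (M ＼ {e}).E, f ≠ e := fun f hf ↦ by rintro rfl; exact heE hf
  have ha : ∀ f ∈ (M ＼ {e}).E, a' f = .inl (a f) := fun f hf ↦ by simp [a', hne f hf]
  have hb : ∀ f ∈ (M ＼ {e}).E, b' f = .inl (b f) := fun f hf ↦ by simp [b', hne f hf]
  refine ⟨V ⊕ Bool, inferInstance, a', b', ?_⟩
  rw [delete_singleton_ground he.mem_ground]
  refine ⟨⟨d.addComponent false heE ha hb (by simp [a']) (by simp [b'])⟩, fun C ↦ ?_⟩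
  have hloop : (ofEnds (insert e (M ＼ {e}).E) a' b').IsLink e (.inr false) (.inr false) :=
    ⟨mem_insert _ _, .inl (by simp [a', b'])⟩
  by_cases heC : e ∈ C
  · constructor
    · intro h
      rw [← (singleton_isCircuit.2 he).eq_of_subset_isCircuit h (singleton_subset_iff.2 heC)]
      exact isCycleEdgeSet_singleton hloop
    · intro h
      rw [h.eq_singleton_of_isLoopAt heC hloop]
      exact singleton_isCircuit.2 he
  · rw [isCycleEdgeSet_ofEnds_addComponent heC ha hb, ← hC, delete_isCircuit_iff,
      and_iff_left (by simpa using heC)]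

open Classical in
lemma IsLensGraphic.of_delete_isColoop (h : (M ＼ {e}).IsLensGraphic) (he : M.IsColoop e) :
    M.IsLensGraphic := by
  obtain ⟨V, _, a, b, ⟨d⟩, hC⟩ := h
  have heE : e ∉ (M ＼ {e}).E := by simp
  let a' : α → V ⊕ Bool := Function.update (.inl ∘ a) e (.inr false)
  let b' : α → V ⊕ Bool := Function.update (.inl ∘ b) e (.inr true)
  have hne : ∀ f ∈ (M ＼ {e}).E, f ≠ e := fun f hf ↦ by rintro rfl; exact heE hf
  have ha : ∀ f ∈ (M ＼ {e}).E, a' f = .inl (a f) := fun f hf ↦ by simp [a', hne f hf]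
  have hb : ∀ f ∈ (M ＼ {e}).E, b' f = .inl (b f) := fun f hf ↦ by simp [b', hne f hf]
  refine ⟨V ⊕ Bool, inferInstance, a', b', ?_⟩
  rw [delete_singleton_ground he.mem_ground]
  refine ⟨⟨d.addComponent true heE ha hb (by simp [a']) (by simp [b'])⟩, fun C ↦ ?_⟩
  by_cases heC : e ∈ C
  · refine iff_of_false (fun h ↦ he.notMem_isCircuit h heC) fun h ↦ ?_
    have hlink : (ofEnds (insert e (M ＼ {e}).E) a' b').IsLink e (.inr false) (.inr true) := by
      simp [a', b']
    -- A cycle through `e` would need a second edge at an end of `e`, and there is none.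
    obtain ⟨f, hf, hfe, hinc⟩ := h.exists_ne_inc heC hlink (by simp)
    have hfE := (h.subset_edgeSet hf).resolve_left hfe
    rw [ofEnds_inc, ha f hfE, hb f hfE] at hinc
    simp at hinc
  · rw [isCycleEdgeSet_ofEnds_addComponent heC ha hb, ← hC, delete_isCircuit_iff,
      and_iff_left (by simpa using heC)]

/-- In a circuit, an element may be replaced by a parallel one. -/
lemma IsCircuit.exchange_parallel (hC : M.IsCircuit C) (hef : M.IsCircuit {e, f}) (hne : e ≠ f)
    (heC : e ∈ C) (hfC : f ∉ C) : M.IsCircuit (insert f (C \ {e})) := by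
  have hI := hC.sdiff_singleton_indep heC
  have hecl : e ∈ M.closure (C \ {e}) := hC.mem_closure_sdiff_singleton_of_mem heC
  have hfe : f ∈ M.closure {e} := by
    have := hef.mem_closure_sdiff_singleton_of_mem (e := f) (by simp)
    rwa [show ({e, f} : Set α) \ {f} = {e} by grind] at this
  have hef' : e ∈ M.closure {f} := by
    have := hef.mem_closure_sdiff_singleton_of_mem (e := e) (by simp)
    rwa [show ({e, f} : Set α) \ {e} = {f} by grind] at this
  have hfcl : f ∈ M.closure (C \ {e}) :=
    M.closure_subset_closure_of_subset_closure (singleton_subset_iff.2 hecl) hfe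
  refine hI.insert_isCircuit_of_forall (fun h ↦ hfC h.1) hfcl fun g hg hfg ↦ ?_
  -- If `f` were spanned without `g`, so would be its parallel `e`, against the independence of `C \
  -- {g}`.
  have heg : e ∈ M.closure ((C \ {e}) \ {g}) :=
    M.closure_subset_closure_of_subset_closure (singleton_subset_iff.2 hfg) hef'
  have hsub : (C \ {e}) \ {g} ⊆ (C \ {g}) \ {e} := by grind
  exact ((hC.sdiff_singleton_indep hg.1).notMem_closure_sdiff_of_mem ⟨heC, fun h ↦ hg.2 h.symm⟩)
    (M.closure_subset_closure hsub heg)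

open Classical in
-- In the matroid and in the graph alike, circuits avoiding `e` are the old ones, `{e, f}` is the
-- only one containing both, and the transposition of `e` and `f` turns those through `e` alone into
-- those through `f` alone.
lemma IsLensGraphic.of_delete_parallel (h : (M ＼ {e}).IsLensGraphic) (hef : M.IsCircuit {e, f})
    (hne : e ≠ f) : M.IsLensGraphic := by
  obtain ⟨V, hV, a, b, ⟨d⟩, hC⟩ := h
  have heM : e ∈ M.E := hef.subset_ground (by simp)
  have heE : e ∉ (M ＼ {e}).E := by simp
  have hfE : f ∈ (M ＼ {e}).E := ⟨hef.subset_ground (by simp), fun h ↦ hne h.symm⟩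
  let a' : α → V := Function.update a e (a f)
  let b' : α → V := Function.update b e (b f)
  have hne' : ∀ f ∈ (M ＼ {e}).E, f ≠ e := fun f hf ↦ by rintro rfl; exact heE hf
  have ha : ∀ f ∈ (M ＼ {e}).E, a' f = a f := fun f hf ↦ by simp [a', hne' f hf]
  have hb : ∀ f ∈ (M ＼ {e}).E, b' f = b f := fun f hf ↦ by simp [b', hne' f hf]
  have hae : a' e = a f := by simp [a']
  have hbe : b' e = b f := by simp [b']
  refine ⟨V, hV, a', b', ?_⟩
  rw [delete_singleton_ground heM]
  refine ⟨⟨d.addParallel heE hfE ha hb hae hbe⟩, ?_⟩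
  set E := (M ＼ {e}).E
  set G' := ofEnds (insert e E) a' b' with hG'
  have hle : G'.IsLink e (a f) (b f) := by simp [hG', hae, hbe]
  have hlf : G'.IsLink f (a f) (b f) := by simp [hG', ha f hfE, hb f hfE, hfE]
  have hab : a f ≠ b f := by
    intro hab
    have h1 : (M ＼ {e}).IsCircuit {f} := (hC _).2
      (isCycleEdgeSet_singleton (x := a f) ⟨hfE, .inl ⟨rfl, hab.symm⟩⟩)
    have := h1.of_delete.eq_of_subset_isCircuit hef (by simp)
    exact hne ((this ▸ (by simp) : e ∈ ({f} : Set α)))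
  have hold : ∀ C, e ∉ C → (M.IsCircuit C ↔ G'.IsCycleEdgeSet C) := by
    intro C heC
    have h1 : M.IsCircuit C ↔ (M ＼ {e}).IsCircuit C := by
      rw [delete_isCircuit_iff, and_iff_left (by simpa using heC)]
    rw [h1, hC]
    constructor
    · refine fun h ↦ h.map id (fun _ _ _ _ _ _ _ _ h ↦ h) ?_
      rintro g hg x y ⟨hgE, h⟩
      exact ⟨.inr hgE, by rwa [ha g hgE, hb g hgE]⟩
    · refine fun h ↦ h.map id (fun _ _ _ _ _ _ _ _ h ↦ h) ?_
      rintro g hg x y ⟨hgE, h⟩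
      have hgE := hgE.resolve_left (by rintro rfl; exact heC hg)
      exact ⟨hgE, by rwa [ha g hgE, hb g hgE] at h⟩
  have hswap : ∀ C, e ∈ C → f ∉ C → Equiv.swap e f '' C = insert f (C \ {e}) := by
    intro C heC hfC
    rw [Equiv.image_eq_preimage_symm]
    ext x
    simp only [Equiv.symm_swap, mem_preimage, Equiv.swap_apply_def]
    grind
  have hswaplink : ∀ g x y, G'.IsLink g x y → G'.IsLink (Equiv.swap e f g) x y := by
    intro g x y h
    rw [Equiv.swap_apply_def]
    split_ifs with h1 h2
    · subst h1
      rw [hle.isLink_iff] at h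
      rwa [hlf.isLink_iff]
    · subst h2
      rw [hlf.isLink_iff] at h
      rwa [hle.isLink_iff]
    · exact h
  intro C
  by_cases heC : e ∈ C
  swap
  · exact hold C heC
  by_cases hfC : f ∈ C
  · constructor
    · intro h
      rw [← hef.eq_of_subset_isCircuit h (by grind)]
      exact isCycleEdgeSet_pair hle hlf hab hne
    · intro h
      rwa [h.eq_pair heC hfC hne hle hlf]
  have hback : insert e (insert f (C \ {e}) \ {f}) = C := by grind
  constructor
  · intro h
    have h1 := (hold _ (by grind)).1 (h.exchange_parallel hef hne heC hfC)
    have h2 := h1.image_edges (Equiv.swap e f).injective fun g _ ↦ hswaplink g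
    rw [← hswap C heC hfC, image_image] at h2
    simpa using h2
  · intro h
    have h1 := h.image_edges (Equiv.swap e f).injective fun g _ ↦ hswaplink g
    rw [hswap C heC hfC] at h1
    have h2 := ((hold _ (by grind)).2 h1).exchange_parallel (e := f) (f := e)
      (by rwa [pair_comm]) hne.symm (by simp) (by grind)
    rwa [hback] at h2

/-- The circuits of a matroid in terms of a contraction by an element of a series pair. -/
lemma isCircuit_iff_of_series (hne : e ≠ f) (hser : ∀ C, M.IsCircuit C → (e ∈ C ↔ f ∈ C)) :
    M.IsCircuit C ↔ (e ∈ C ∧ f ∈ C ∧ (M ／ {e}).IsCircuit (C \ {e})) ∨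
      (e ∉ C ∧ f ∉ C ∧ (M ／ {e}).IsCircuit C) := by
  constructor
  · intro hC
    by_cases heC : e ∈ C
    · have hfC := (hser C hC).1 heC
      exact .inl ⟨heC, hfC, hC.contractElem_isCircuit ⟨e, heC, f, hfC, hne⟩ heC⟩
    · have hfC := mt (hser C hC).2 heC
      obtain ⟨C₁, hC₁C, hC₁⟩ := (hC.contract_dep (C := {e}) (by simpa using heC)).exists_isCircuit_subset
      obtain ⟨C', hC', h1, h2⟩ := hC₁.exists_subset_isCircuit_of_contract
      -- If the lifted circuit contained `e`, it would contain `f`, which is not available in `C`.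
      have heC' : e ∉ C' := fun h ↦ by
        rcases h2 ((hser C' hC').1 h) with h3 | h3
        · exact hfC (hC₁C h3)
        · exact hne h3.symm
      have h3 : C' ⊆ C := fun x hx ↦ by
        rcases h2 hx with h | h
        · exact hC₁C h
        · exact (heC' (h ▸ hx)).elim
      have h4 := hC'.eq_of_subset_isCircuit hC h3
      have h5 : C₁ = C := hC₁C.antisymm (h4 ▸ fun x hx ↦ (h2 hx).resolve_right fun h ↦ heC' (h ▸ hx))
      exact .inr ⟨heC, hfC, h5 ▸ hC₁⟩
  · rintro (⟨heC, hfC, hC⟩ | ⟨heC, hfC, hC⟩)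
    · obtain ⟨C', hC', h1, h2⟩ := hC.exists_subset_isCircuit_of_contract
      have heC' := (hser C' hC').2 (h1 ⟨hfC, fun h ↦ hne h.symm⟩)
      have : C' = C := by grind
      rwa [← this]
    · obtain ⟨C', hC', h1, h2⟩ := hC.exists_subset_isCircuit_of_contract
      have hfC' : f ∉ C' := by grind
      have heC' := mt (hser C' hC').1 hfC'
      have : C' = C := by grind
      rwa [← this]

end Matroid

/-! ### Subdivision and series elements -/

namespace Graph

variable {V α : Type*} {C E : Set α} {e f : α} {a b : α → V} {a' b' : α → Option V}

/-- The cycles of the graph that arises by subdividing the edge `f`, where the second half of `f`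
is the new edge `e`. -/
lemma isCycleEdgeSet_subdivide_iff (he : e ∉ E) (hf : f ∈ E)
    (ha : ∀ g ∈ E, a' g = some (a g)) (hb : ∀ g ∈ E, g ≠ f → b' g = some (b g))
    (hbf : b' f = none) (hae : a' e = none) (hbe : b' e = some (b f)) :
    (ofEnds (insert e E) a' b').IsCycleEdgeSet C ↔
      (e ∈ C ∧ f ∈ C ∧ (ofEnds E a b).IsCycleEdgeSet (C \ {e})) ∨
      (e ∉ C ∧ f ∉ C ∧ (ofEnds E a b).IsCycleEdgeSet C) := by
  set G := ofEnds E a b with hG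
  set G' := ofEnds (insert e E) a' b' with hG'
  have hef : e ≠ f := by rintro rfl; exact he hf
  have hle : G'.IsLink e none (some (b f)) := by simp [hG', hae, hbe]
  have hlf : G'.IsLink f none (some (a f)) := by simp [hG', ha f hf, hbf, hf]
  have hfG : G.IsLink f (a f) (b f) := by simp [hG, hf]
  have hinc : ∀ g, G'.Inc g none → g = e ∨ g = f := by
    intro g hg
    rw [hG', ofEnds_inc] at hg
    obtain ⟨rfl | hgE, h⟩ := hg
    · exact .inl rfl
    · by_contra! hne
      rw [ha g hgE, hb g hgE hne.2] at h
      simp at h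
  have hlink : ∀ g, g ≠ e → g ≠ f → ∀ x y, G'.IsLink g (some x) (some y) ↔ G.IsLink g x y := by
    intro g hge hgf x y
    simp only [hG, hG', ofEnds_isLink, mem_insert_iff, hge, false_or]
    refine and_congr_right fun hgE ↦ ?_
    rw [ha g hgE, hb g hgE hgf]
    simp
  have hser : G'.IsCycleEdgeSet C → (e ∈ C ↔ f ∈ C) := by
    intro h
    constructor <;> intro hC
    · obtain ⟨g, hg, hge, hgi⟩ := h.exists_ne_inc hC hle (by simp)
      rwa [(hinc g hgi).resolve_left hge] at hg
    · obtain ⟨g, hg, hgf, hgi⟩ := h.exists_ne_inc hC hlf (by simp)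
      rwa [(hinc g hgi).resolve_right hgf] at hg
  have hvert : ∀ C, e ∉ C → f ∉ C → (G'.IsCycleEdgeSet C ↔ G.IsCycleEdgeSet C) := by
    intro C heC hfC
    have hne : ∀ g ∈ C, g ≠ e ∧ g ≠ f := fun g hg ↦
      ⟨by rintro rfl; exact heC hg, by rintro rfl; exact hfC hg⟩
    have hsome : ∀ g ∈ C, ∀ x, G'.Inc g x → ∃ y, x = some y := by
      rintro g hg (_ | x) h
      · exact ((hinc g h).elim (hne g hg).1 (hne g hg).2).elim
      · exact ⟨x, rfl⟩
    constructor
    · refine fun h ↦ h.map (fun x ↦ x.getD (a f)) ?_ ?_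
      · intro g hg g' hg' x y hx hy hxy
        obtain ⟨x, rfl⟩ := hsome g hg x hx
        obtain ⟨y, rfl⟩ := hsome g' hg' y hy
        simpa using hxy
      · intro g hg x y hxy
        obtain ⟨x, rfl⟩ := hsome g hg x hxy.inc_left
        obtain ⟨y, rfl⟩ := hsome g hg y hxy.inc_right
        exact (hlink g (hne g hg).1 (hne g hg).2 x y).1 hxy
    · exact fun h ↦ h.map some (fun _ _ _ _ _ _ _ _ h ↦ Option.some_injective _ h)
        fun g hg x y hxy ↦ (hlink g (hne g hg).1 (hne g hg).2 x y).2 hxy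
  have hthrough : e ∈ C → f ∈ C → (G'.IsCycleEdgeSet C ↔ G.IsCycleEdgeSet (C \ {e})) := by
    intro heC hfC
    constructor
    · intro h
      obtain ⟨x, y, U, D, hl, hp, heD, rfl⟩ := isCycleEdgeSet_and_mem_iff.1 ⟨h, heC⟩
      have hp' : G'.IsPathSet none (some (b f)) U D := by
        rcases hle.eq_and_eq_or_eq_and_eq hl with ⟨rfl, rfl⟩ | ⟨rfl, rfl⟩
        exacts [hp, hp.reverse]
      have hD : insert e D \ {e} = D := by grind
      rw [hD]
      cases hp' with
      | @cons g _ y' _ U' D' hg hp'' hU =>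
        -- The cycle without `e` is a path from the subdividing vertex, which must begin with `f`;
        -- the rest is a path of the old graph between the ends of `f`.
        obtain rfl : g = f := (hinc g hg.inc_left).resolve_left (by rintro rfl; simp at heD)
        obtain rfl := hlf.right_unique hg
        have hgD : g ∉ D' := fun h ↦ hU (hp''.left_mem_of_isLink h hlf)
        have hpG : G.IsPathSet (a g) (b g) ((fun x : Option V ↦ x.getD (a g)) '' U') D' := by
          refine hp''.map (G' := G) (fun x : Option V ↦ x.getD (a g)) ?_ ?_
          · rintro (_ | u) hu (_ | v) hv huv
            · rfl
            · exact (hU hu).elim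
            · exact (hU hv).elim
            · simpa using huv
          · rintro g' hg' (_ | u) hu (_ | v) hv huv
            · exact (hU hu).elim
            · exact (hU hu).elim
            · exact (hU hv).elim
            · exact (hlink g' (by rintro rfl; exact heD (.inr hg'))
                (by rintro rfl; exact hgD hg') u v).1 huv
        exact (isCycleEdgeSet_and_mem_iff.2 ⟨_, _, _, _, hfG, hpG, hgD, rfl⟩).1
    · intro h
      obtain ⟨x, y, U, D, hl, hp, hfD, hD⟩ :=
        isCycleEdgeSet_and_mem_iff.1 ⟨h, (⟨hfC, fun h ↦ hef h.symm⟩ : f ∈ C \ {e})⟩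
      have hp' : G.IsPathSet (a f) (b f) U D := by
        rcases hfG.eq_and_eq_or_eq_and_eq hl with ⟨h, h'⟩ | ⟨h, h'⟩
        · rwa [h, h']
        · rw [h, h']
          exact hp.reverse
      have heD : e ∉ D := fun h ↦ by
        have : e ∈ C \ {e} := hD ▸ .inr h
        exact this.2 rfl
      have hpG := hp'.map (G' := G') some (Option.some_injective _).injOn
        fun g hg u _ v _ huv ↦ (hlink g (by rintro rfl; exact heD hg)
          (by rintro rfl; exact hfD hg) u v).2 huv
      have hC : C = insert e (insert f D) := by rw [← hD]; grind
      rw [hC]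
      exact (isCycleEdgeSet_and_mem_iff.2 ⟨_, _, _, _, hle, .cons hlf hpG (by simp),
        by simp [hef, heD], rfl⟩).1
  by_cases heC : e ∈ C <;> by_cases hfC : f ∈ C
  · simp [heC, hfC, hthrough heC hfC]
  · simpa [heC, hfC] using hser
  · simpa [heC, hfC] using hser
  · simp [heC, hfC, hvert C heC hfC]

end Graph

namespace Matroid

variable {α : Type*} {M : Matroid α} {C : Set α} {e f : α}

open Graph

open Classical in
lemma IsLensGraphic.of_contract_series (h : (M ／ {e}).IsLensGraphic) (he : e ∈ M.E) (hf : f ∈ M.E)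
    (hne : e ≠ f) (hser : ∀ C, M.IsCircuit C → (e ∈ C ↔ f ∈ C)) : M.IsLensGraphic := by
  obtain ⟨V, _, a, b, ⟨d⟩, hC⟩ := h
  have heE : e ∉ (M ／ {e}).E := by simp
  have hfE : f ∈ (M ／ {e}).E := ⟨hf, fun h ↦ hne h.symm⟩
  let a' : α → Option V := Function.update (some ∘ a) e none
  let b' : α → Option V := Function.update (Function.update (some ∘ b) f none) e (some (b f))
  have hne' : ∀ f ∈ (M ／ {e}).E, f ≠ e := fun f hf ↦ by rintro rfl; exact heE hf
  have ha : ∀ f ∈ (M ／ {e}).E, a' f = some (a f) := fun f hf ↦ by simp [a', hne' f hf]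
  have hb : ∀ g ∈ (M ／ {e}).E, g ≠ f → b' g = some (b g) := fun g hg hgf ↦ by
    simp [b', hne' g hg, hgf]
  have hbf : b' f = none := by simp [b', hne.symm]
  have hae : a' e = none := by simp [a']
  have hbe : b' e = some (b f) := by simp [b']
  have hE : M.E = insert e (M ／ {e}).E := by
    rw [contract_ground, insert_sdiff_singleton, insert_eq_of_mem he]
  refine ⟨Option V, inferInstance, a', b', ?_⟩
  rw [hE]
  refine ⟨⟨d.subdivide heE hfE ha hb hbf hae hbe⟩, fun C ↦ ?_⟩
  rw [isCycleEdgeSet_subdivide_iff heE hfE ha hb hbf hae hbe, isCircuit_iff_of_series hne hser, hC,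
    hC]

lemma IsLensGraphic.of_delete_mem_closure (h : (M ＼ {e}).IsLensGraphic) (hne : e ≠ f)
    (he : e ∈ M.closure {f}) : M.IsLensGraphic := by
  by_cases hl : M.IsLoop e
  · exact h.of_delete_isLoop hl
  have hnl := (not_isLoop_iff (mem_ground_of_mem_closure he)).1 hl
  refine h.of_delete_parallel (f := f) ?_ hne
  rw [← hnl.closure_eq_closure_iff_isCircuit_of_ne hne]
  exact hnl.closure_eq_of_mem_closure he

end Matroid

/-! ### Finite contractions of branch matroids are planar -/

section

open Matroid

variable {α : Type*} [PartialOrder α] [WellFoundedLT α] {E C J : Set α} {Ω : Set (Set α)}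
  {hΩ : IsBranchFamily Ω} {s t : α}

lemma branchMatroid_isColoop
    (h : ∀ J, BranchIndep E Ω J → BranchIndep E Ω (insert s J)) :
    (branchMatroid E hΩ).IsColoop s := by
  rw [isColoop_iff_forall_mem_isBase]
  intro B hB
  exact hB.mem_of_insert_indep (h B hB.indep)

/-- This is one half of being in series; it is applied to siblings in both orders. -/
lemma branchMatroid_circuit_mem (hins : ∀ J, BranchIndep E Ω J → s ∉ J → t ∉ J →
    BranchIndep E Ω (insert s J)) (hC : (branchMatroid E hΩ).IsCircuit C) (hs : s ∈ C) : t ∈ C := by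
  by_contra ht
  refine hC.not_indep ?_
  have := hins _ (hC.sdiff_singleton_indep hs) (by simp) (fun h ↦ ht h.1)
  rwa [insert_sdiff_singleton, insert_eq_of_mem hs] at this

/-- Finite contractions of finite branch matroids are graphic with a lens drawing. -/
lemma branchMatroid_contract_isLensGraphic (hE : E.Finite) (hΩ : IsBranchFamily Ω) (C : Set α) :
    (branchMatroid E hΩ ／ C).IsLensGraphic := by
  induction hn : E.ncard using Nat.strong_induction_on generalizing E Ω C with
  | _ n ih =>
  have ih' : ∀ s ∈ E, ∀ (Ω' : Set (Set α)) (hΩ' : IsBranchFamily Ω') (C' : Set α),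
      (branchMatroid (E \ {s}) hΩ' ／ C').IsLensGraphic := fun s hs Ω' hΩ' C' ↦
    ih _ (hn ▸ ncard_sdiff_singleton_lt_of_mem hs hE) (hE.subset sdiff_subset) hΩ' C' rfl
  clear ih hn n
  rcases E.eq_empty_or_nonempty with rfl | hne
  · exact isLensGraphic_of_ground_eq_empty (by simp)
  have hcon : ∀ s, Maximal (· ∈ E) s → s ∈ C → (branchMatroid E hΩ ／ C).IsLensGraphic := by
    intro s hs hsC
    have := ih' s hs.1 _ (hΩ.mono (Ω' := {b ∈ Ω | s ∉ b}) (sep_subset _ _)) C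
    rwa [← branchMatroid_contract_maximal hs, contract_contract,
      union_eq_self_of_subset_left (singleton_subset_iff.2 hsC)] at this
  have hdel : ∀ s ∈ E, s ∉ C → ((branchMatroid E hΩ ／ C) ＼ {s}).IsLensGraphic := by
    intro s hs hsC
    rw [contract_delete_comm _ (by simpa using hsC), branchMatroid_delete]
    exact ih' s hs _ hΩ C
  have hloop : ∀ s, Maximal (· ∈ E) s → (∀ b ∈ Ω, s ∉ b) →
      (branchMatroid E hΩ ／ C).IsLensGraphic := by
    intro s hs hsb
    by_cases hsC : s ∈ C
    · exact hcon s hs hsC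
    refine (hdel s hs.1 hsC).of_delete_isLoop ?_
    rw [contract_isLoop_iff_mem_closure, and_iff_left hsC]
    refine IsLoop.mem_closure ?_ C
    rw [← not_isNonloop_iff (by exact hs.1), ← indep_singleton]
    intro h
    obtain ⟨b, hb, hsb', -⟩ := h.2 s rfl
    exact hsb b hb hsb'
  have hcoloop : ∀ s ∈ E, s ∉ C → (∀ J, BranchIndep E Ω J → BranchIndep E Ω (insert s J)) →
      (branchMatroid E hΩ ／ C).IsLensGraphic := by
    intro s hs hsC h
    refine (hdel s hs hsC).of_delete_isColoop ?_
    rw [contract_isColoop_iff]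
    exact ⟨branchMatroid_isColoop h, hsC⟩
  -- Depth is counted within `E`. Greatest depth, rather than mere maximality, ensures that the
  -- other elements above the predecessor of `s` are leaves too.
  obtain ⟨s, hsE, hs⟩ := hE.exists_maximalFor (fun s ↦ (E ∩ Iio s).ncard) E hne
  have hdepth : ∀ t ∈ E, ∀ u ∈ E, t < u → (E ∩ Iio t).ncard < (E ∩ Iio u).ncard := by
    intro t ht u hu htu
    refine ncard_lt_ncard ⟨fun x hx ↦ ⟨hx.1, hx.2.trans htu⟩, fun h ↦ ?_⟩
      (hE.subset inter_subset_left)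
    exact lt_irrefl _ (h ⟨ht, htu⟩).2
  have hmax : ∀ u ∈ E, (E ∩ Iio s).ncard ≤ (E ∩ Iio u).ncard → Maximal (· ∈ E) u := by
    intro u hu hsu
    refine ⟨hu, fun v hv huv ↦ ?_⟩
    rcases huv.eq_or_lt with rfl | hlt
    · exact le_rfl
    · have h1 := hdepth u hu v hv hlt
      have h2 : (E ∩ Iio v).ncard ≤ (E ∩ Iio s).ncard := by
        by_contra! h
        exact h.not_ge (hs hv h.le)
      omega
  have hsmax := hmax s hsE le_rfl
  by_cases hsb : ∀ b ∈ Ω, s ∉ b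
  · exact hloop s hsmax hsb
  push Not at hsb
  obtain ⟨b, hb, hsb⟩ := hsb
  by_cases hsC : s ∈ C
  · exact hcon s hsmax hsC
  have hlast : ∀ u, Maximal (· ∈ E) u → ∀ b ∈ Ω, u ∈ b → ∀ z ∈ E, z ∈ b → z ≤ u := by
    intro u hu b hb hub z hz hzb
    rcases hΩ.chain b hb z hzb u hub with h | h
    · exact h
    · exact hu.2 hz h
  obtain hno | ⟨t, htE, hts, ht⟩ := hΩ.exists_last_lt hb hsb E
  · exact hcoloop s hsE hsC fun J hJ ↦ hJ.insert hΩ hsE hb hsb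
      (fun z hz hzb ↦ hlast s hsmax b hb hsb z (hJ.1 hz) hzb)
      fun t ht hts ↦ (hno t (hJ.1 ht) hts).elim
  -- If `t` is last in `E` on some branch, that branch frees `s` from any conflict with `t`, and `s`
  -- is a coloop.
  by_cases hpriv : ∃ c ∈ Ω, t ∈ c ∧ ∀ z ∈ E, z ∈ c → z ≤ t
  · obtain ⟨c, hc, htc, hlastc⟩ := hpriv
    refine hcoloop s hsE hsC fun J hJ ↦ hJ.insert hΩ hsE hb hsb
      (fun z hz hzb ↦ hlast s hsmax b hb hsb z (hJ.1 hz) hzb) fun u hu hus humax ↦ ?_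
    have hut := ht u (hJ.1 hu) hus
    refine ⟨c, hc, hΩ.lower c hc hut htc, fun h ↦ (hlastc s hsE h).not_gt hts, fun z hz hzc ↦ ?_⟩
    exact humax z hz ((hlastc z (hJ.1 hz) hzc).trans_lt hts)
  by_cases hsib : ∃ u ∈ E, u ≠ s ∧ t < u
  · obtain ⟨u, huE, hus, htu⟩ := hsib
    have humax : Maximal (· ∈ E) u := by
      refine hmax u huE (ncard_le_ncard (fun z hz ↦ ⟨hz.1, (ht z hz.1 hz.2).trans_lt htu⟩)
        (hE.subset inter_subset_left))
    by_cases hub : ∀ b ∈ Ω, u ∉ b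
    · exact hloop u humax hub
    push Not at hub
    obtain ⟨c, hc, huc⟩ := hub
    by_cases huC : u ∈ C
    · exact hcon u humax huC
    have htu' : ∀ z ∈ E, z < u → z ≤ t := by
      intro z hz hzu
      rcases hΩ.chain c hc t (hΩ.lower c hc htu.le huc) z (hΩ.lower c hc hzu.le huc) with h | h
      · rcases h.eq_or_lt with rfl | htz
        · exact le_rfl
        · have := hmax z hz (ncard_le_ncard
            (fun y hy ↦ ⟨hy.1, (ht y hy.1 hy.2).trans_lt htz⟩) (hE.subset inter_subset_left))
          exact ((this.2 huE hzu.le).not_gt hzu).elim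
      · exact h
    -- While `u` is absent from `J`, the branch through `u` serves the predecessor of `s` in `J`.
    -- Hence `s` and `u` are in series.
    have hins : ∀ s u, s ≠ u → ∀ b ∈ Ω, ∀ c ∈ Ω, Maximal (· ∈ E) s → Maximal (· ∈ E) u → t < s →
        t < u → s ∈ b → u ∈ c → (∀ z ∈ E, z < s → z ≤ t) → (∀ z ∈ E, z < u → z ≤ t) →
        ∀ J, BranchIndep E Ω J → s ∉ J → u ∉ J → BranchIndep E Ω (insert s J) := by
      intro s u hsu b hb c hc hs hu hts htu hsb huc hzs hzu J hJ hsJ huJ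
      refine hJ.insert hΩ hs.1 hb hsb (fun z hz hzb ↦ hlast s hs b hb hsb z (hJ.1 hz) hzb)
        fun t' ht' hts' hmax' ↦ ?_
      have htt' := hzs t' (hJ.1 ht') hts'
      refine ⟨c, hc, hΩ.lower c hc (htt'.trans htu.le) huc, fun hsc ↦ ?_, fun z hz hzc ↦ ?_⟩
      · exact hsu ((hlast u hu c hc huc s hs.1 hsc).antisymm
          (hs.2 hu.1 (hlast u hu c hc huc s hs.1 hsc)))
      · have hzu' := (hlast u hu c hc huc z (hJ.1 hz) hzc).lt_of_ne (by rintro rfl; exact huJ hz)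
        exact hmax' z hz ((hzu z (hJ.1 hz) hzu').trans_lt hts)
    have hserL : ∀ C, (branchMatroid E hΩ).IsCircuit C → (s ∈ C ↔ u ∈ C) := fun C hC ↦
      ⟨branchMatroid_circuit_mem (hins s u hus.symm b hb c hc hsmax humax hts htu hsb huc ht htu') hC,
        branchMatroid_circuit_mem (hins u s hus c hc b hb humax hsmax htu hts huc hsb htu' ht) hC⟩
    refine IsLensGraphic.of_contract_series (e := s) (f := u) ?_ ⟨hsE, hsC⟩ ⟨huE, huC⟩ hus.symm ?_
    · rw [contract_comm, branchMatroid_contract_maximal hsmax]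
      exact ih' s hsE _ _ C
    · intro D hD
      obtain ⟨D', hD', h1, h2⟩ := hD.exists_subset_isCircuit_of_contract
      have := hserL D' hD'
      grind
  · push Not at hsib
    -- Here every branch through `t` on which something of `E` follows passes through `s`, and `t`
    -- is last on none, so `{s, t}` is dependent.
    refine (hdel s hsE hsC).of_delete_mem_closure (f := t) hts.ne' ?_
    rw [contract_closure_eq]
    refine ⟨closure_subset_closure _ subset_union_left ?_, hsC⟩
    have hti : (branchMatroid E hΩ).Indep {t} := by
      refine ⟨by simpa using htE, ?_⟩
      rintro _ rfl
      exact ⟨b, hb, hΩ.lower b hb hts.le hsb, by simp⟩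
    by_contra hcl
    rw [hti.notMem_closure_iff (by exact hsE)] at hcl
    obtain ⟨c, hc, htc, hlastc⟩ := hcl.1.2 t (by simp)
    refine hpriv ⟨c, hc, htc, fun z hz hzc ↦ ?_⟩
    rcases hΩ.chain c hc z hzc t htc with h | h
    · exact h
    · rcases h.eq_or_lt with rfl | htz
      · exact le_rfl
      · obtain rfl : z = s := by
          by_contra hzs
          exact hsib z hz hzs htz
        exact hlastc z (mem_insert _ _) hzc

end

/-! ### The binary tree and its branch matroids -/

open Matroid

universe u v w

/-- The nodes of the infinite binary tree. -/
structure BinaryWord : Type u where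
  word : List Bool

namespace BinaryWord

lemma word_injective : Function.Injective BinaryWord.word := by
  rintro ⟨s⟩ ⟨t⟩ rfl
  rfl

instance : Countable BinaryWord := word_injective.countable

instance : PartialOrder BinaryWord where
  le s t := s.word <+: t.word
  le_refl s := List.prefix_rfl
  le_trans _ _ _ := List.IsPrefix.trans
  le_antisymm _ _ hst hts := word_injective (hst.eq_of_length_le hts.length_le)

lemma le_def {s t : BinaryWord} : s ≤ t ↔ s.word <+: t.word := Iff.rfl

instance : WellFoundedLT BinaryWord where
  wf := Subrelation.wf (r := InvImage (· < ·) fun s : BinaryWord ↦ s.word.length)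
    (fun {s _} (h : s < _) ↦ by
      refine (le_def.1 h.le).length_le.lt_of_ne fun hlen ↦ h.ne ?_
      exact word_injective ((le_def.1 h.le).eq_of_length hlen))
    (InvImage.wf _ wellFounded_lt)

lemma finite_Iic (s : BinaryWord) : (Iic s).Finite :=
  Finite.of_injOn (t := {l | l ∈ s.word.inits}) (fun _ ht ↦ (List.mem_inits _ _).2 ht)
    word_injective.injOn (List.finite_toSet _)

/-- The branch of the binary tree that consists of the initial segments of `x`. -/
def branch (x : ℕ → Bool) : Set BinaryWord := {s | ∃ n, s.word = (List.range n).map x}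

lemma map_range_prefix (x : ℕ → Bool) {m n : ℕ} (h : m ≤ n) :
    (List.range m).map x <+: (List.range n).map x := by
  refine List.IsPrefix.map x ?_
  rw [List.prefix_iff_eq_take, List.take_range]
  simp [h]

lemma isBranchFamily_range_branch : IsBranchFamily (range branch) where
  lower := by
    rintro _ ⟨x, rfl⟩ t s hst ⟨n, hn⟩
    rw [le_def, hn, List.prefix_iff_eq_take, ← List.map_take, List.take_range] at hst
    exact ⟨_, hst⟩
  chain := by
    rintro _ ⟨x, rfl⟩ s ⟨m, hm⟩ t ⟨n, hn⟩
    rw [le_def, le_def, hm, hn]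
    exact (le_total m n).imp (map_range_prefix x) (map_range_prefix x)
  finite _ _ s _ := finite_Iic s

/-- A branch has exactly one word of each length, so its words determine the sequence letter by
letter. -/
lemma eq_of_branch_subset {x y : ℕ → Bool} (h : branch x ⊆ branch y) : x = y := by
  funext n
  obtain ⟨m, hm⟩ := h (⟨n + 1, rfl⟩ : (⟨(List.range (n + 1)).map x⟩ : BinaryWord) ∈ branch x)
  have hlen : n + 1 = m := by simpa using congrArg List.length hm
  subst hlen
  exact List.map_inj_left.1 hm n (by simp)

lemma isAntichain_range_branch : IsAntichain (· ⊆ ·) (range branch) := by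
  rintro _ ⟨x, rfl⟩ _ ⟨y, rfl⟩ hne h
  exact hne (by rw [eq_of_branch_subset h])

lemma isBranchFamily_image_branch (Z : Set (ℕ → Bool)) : IsBranchFamily (branch '' Z) :=
  isBranchFamily_range_branch.mono (image_subset_range _ _)

/-- The branch matroid on the binary tree for the branches in `Z`. -/
def treeMatroid (Z : Set (ℕ → Bool)) : Matroid BinaryWord.{u} :=
  branchMatroid univ (isBranchFamily_image_branch Z)

lemma treeMatroid_isCountablePlanar (Z : Set (ℕ → Bool)) : (treeMatroid.{u} Z).IsCountablePlanar := by
  refine ⟨to_countable _, branchMatroid_isTame, fun N hN hfin ↦ ?_⟩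
  obtain ⟨Ω, hΩ, F, C, hF, rfl⟩ := branchMatroid_exists_finite_contract hN hfin
  exact (branchMatroid_contract_isLensGraphic hF hΩ C).isFinitePlanar hfin

lemma subset_of_treeMatroid_eq {Z Z' : Set (ℕ → Bool)}
    (h : treeMatroid.{u} Z = treeMatroid Z') : Z ⊆ Z' := by
  intro x hx
  obtain ⟨y, hy, hyx⟩ := mem_of_branchMatroid_univ_eq h (mem_image_of_mem _ hx)
    ⟨⟨[]⟩, 0, rfl⟩ (isAntichain_range_branch.subset
      (insert_subset (mem_range_self x) (image_subset_range _ _)))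
  rwa [← eq_of_branch_subset hyx.le]

lemma treeMatroid_injective : Function.Injective treeMatroid.{u} := fun _ _ h ↦
  (subset_of_treeMatroid_eq h).antisymm (subset_of_treeMatroid_eq h.symm)

end BinaryWord

/-! ### Counting the minors of a countable matroid -/

namespace Matroid

variable {α : Type u} {β : Type v} {M : Matroid α} {N : Matroid β}

/-- The independent sets of a matroid that is isomorphic to a minor of `M`, where `A` codes the
minor and the isomorphism. -/
def CodedIndep (M : Matroid α) (A : Set (M.E ⊕ M.E ⊕ M.E × β)) (J : Set β) : Prop :=
  (M ／ (Subtype.val '' {c | .inl c ∈ A}) ＼ (Subtype.val '' {d | .inr (.inl d) ∈ A})).Indep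
    (Subtype.val '' {a | ∃ x ∈ J, .inr (.inr (a, x)) ∈ A})

/-- The code consists of the contracted set, the deleted set and the graph of the isomorphism. Its
type depends only on `M` and on the ground type of `N`. -/
lemma HasAsMinor.exists_code (h : M.HasAsMinor N) (hN : N.E = univ) :
    ∃ A, ∀ J, N.Indep J ↔ M.CodedIndep A J := by
  obtain ⟨M', hM', f, hf⟩ := h
  obtain ⟨C, D, hC, hD, -, rfl⟩ := hM'.exists_eq_contract_delete_disjoint
  let A : Set (M.E ⊕ M.E ⊕ M.E × β) := {k | k.elim (fun c ↦ c.1 ∈ C) (Sum.elim (fun d ↦ d.1 ∈ D)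
    fun p ↦ ∃ h : p.1.1 ∈ (M ／ C ＼ D).E, (f ⟨p.1.1, h⟩ : β) = p.2)}
  refine ⟨A, fun J ↦ ?_⟩
  have hAC : Subtype.val '' {c : M.E | .inl c ∈ A} = C := by
    ext x
    exact ⟨by rintro ⟨c, hc, rfl⟩; exact hc, fun hx ↦ ⟨⟨x, hC hx⟩, hx, rfl⟩⟩
  have hAD : Subtype.val '' {d : M.E | .inr (.inl d) ∈ A} = D := by
    ext x
    exact ⟨by rintro ⟨c, hc, rfl⟩; exact hc, fun hx ↦ ⟨⟨x, hD hx⟩, hx, rfl⟩⟩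
  have hAJ : Subtype.val '' {a : M.E | ∃ x ∈ J, .inr (.inr (a, x)) ∈ A} =
      (fun x : (M ／ C ＼ D).E ↦ (x : α)) '' {a | (f a : β) ∈ J} := by
    ext x
    constructor
    · rintro ⟨a, ⟨y, hy, ha, hay⟩, rfl⟩
      have hay : (f ⟨a, ha⟩ : β) = y := hay
      exact ⟨⟨a, ha⟩, by rwa [mem_ofPred_eq, hay], rfl⟩
    · rintro ⟨a, ha, rfl⟩
      exact ⟨⟨a, a.2.1.1⟩, ⟨f a, ha, a.2, rfl⟩, rfl⟩
  have hJ : (fun x : (M ／ C ＼ D).E ↦ (f x : β)) '' {a | (f a : β) ∈ J} = J := by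
    ext y
    refine ⟨by rintro ⟨a, ha, rfl⟩; exact ha, fun hy ↦ ?_⟩
    have hfy := congrArg Subtype.val (f.apply_symm_apply ⟨y, hN ▸ mem_univ y⟩)
    exact ⟨_, by rwa [mem_ofPred_eq, hfy], hfy⟩
  rw [CodedIndep, hAC, hAD, hAJ, hf, hJ]

end Matroid

lemma exists_injective_set_of_countable (κ : Type w) [Countable κ] :
    ∃ φ : Set κ → ℕ → Bool, Function.Injective φ := by
  classical
  obtain ⟨ι, hι⟩ := exists_injective_nat κ
  refine ⟨fun A n ↦ decide (n ∈ ι '' A), fun A B h ↦ hι.image_injective ?_⟩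
  ext n
  simpa using congrFun h n

theorem corollary1p7 :
    ¬ ∃ (α : Type*) (M : Matroid α), Matroid.IsUniversalFor Matroid.IsCountablePlanar M := by
  rintro ⟨α, M, ⟨hcount, -⟩, huniv⟩
  have hM : Countable M.E := hcount.to_subtype
  choose A hA using fun Z ↦
    (huniv _ _ (BinaryWord.treeMatroid_isCountablePlanar Z)).exists_code rfl
  obtain ⟨φ, hφ⟩ := exists_injective_set_of_countable (M.E ⊕ M.E ⊕ M.E × BinaryWord)
  -- Equal codes give equal independent sets, so coding would embed the power set of `ℕ → Bool` into
  -- `ℕ → Bool`.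
  refine Function.cantor_injective (fun Z ↦ φ (A Z)) fun Z Z' h ↦
    BinaryWord.treeMatroid_injective (ext_indep rfl fun J _ ↦ ?_)
  rw [hA Z J, hA Z' J, hφ h]
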